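/- A (small) non-symmetric operad $\mathcal P$ (also called a multicategory) consists of a set $\mathrm{ob}(\mathcal P)$ of objects, a set $\mathcal P(p_1,\dots,p_n;p_0)$ of morphisms for all $n\ge 0$ and all objects $p_0,\dots,p_n$, identities $\mathrm{id}_p\in\mathcal P(p;p)$, and compositions $\psi\circ(\psi_1,\dots,\psi_n)$ that are associative and unital. A symmetric operad has in addition functions $\sigma^*:\mathcal P(p_1,\dots,p_n;p_0)\to\mathcal P(p_{\sigma(1)},\dots,p_{\sigma(n)};p_0)$ for $\sigma\in\Sigma_n$, with $\mathrm{id}^*=\mathrm{id}$ and $(\sigma\tau)^*=\tau^*\sigma^*$, that are compatible with composition: $\sigma^*\psi\circ(\psi_{\sigma(1)},\dots,\psi_{\sigma(n)})=\bar\sigma^*(\psi\circ(\psi_1,\dots,\psi_n))$, where $\bar\sigma$ is the corresponding permutation of blocks, and $\psi\circ(\tau_1^*\psi_1,\dots,\tau_n^*\psi_n)=(\tau_1\oplus\cdots\oplus\tau_n)^*(\psi\circ(\psi_1,\dots,\psi_n))$. Functors of operads are maps of objects and of morphisms that preserve identities, compositions and, in the symmetric case, the functions $\sigma^*$. Let $\mathbf{Ope}$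 and $\mathbf{Ope}_\Sigma$ be the categories of small non-symmetric and of small symmetric operads, and let $j^*(\mathcal P)$ be the category with the objects and the unary morphisms of $\mathcal P$; an isomorphism in $\mathcal P$ is one in $j^*(\mathcal P)$. **Theorem.** Each of the categories $\mathbf{Ope}$ and $\mathbf{Ope}_\Sigma$ has all small limits and all small colimits and admits a Quillen model structure in which * the weak equivalences are the operadic equivalences, i.e. the functors $F:\mathcal P\to\mathcal Q$ such that $j^*(F)$ is essentially surjective and every component $F:\mathcal P(p_1,\dots,p_n;p_0)\to\mathcal Q(Fp_1,\dots,Fp_n;Fp_0)$, $n\ge 0$, is a bijection; * the cofibrations are the functors that are injective on objects; * the fibrations are the isofibrations, i.e. the functors $F:\mathcal P\to\mathcal Q$ such that for every object $p$ of $\mathcal P$ and every isomorphism $\psi:Fp\to q$ in $\mathcal Q$ there is an isomorphism $\phi:p\to p'$ in $\mathcal P$ with $Fp'=q$ and $F\phi=\psi$. In both model structures every object is fibrant and cofibrant. Here a Quillen model structure consists of three classes of morphisms, each closed under retracts, such that the weak equivalences have the two-out-of-three property, every cofibration has the left lifting property against every fibration whenever one of the two is a weak equivalence, and every morphism factors both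 as a cofibration followed by a fibration that is a weak equivalence, and as a cofibration that is a weak equivalence followed by a fibration. -/

import Mathlib

open CategoryTheory CategoryTheory.Limits HomotopicalAlgebra

universe u

/-! ### Finite sequences -/

/-- A finite sequence `(t₁, …, tₙ)`, `n ≥ 0`, of elements of `α`. -/
structure Tuple (α : Type u) : Type u where
  len : ℕ
  get : Fin len → α

namespace Tuple

variable {α β : Type u}

/-- The sequence of length one. -/
abbrev single (a : α) : Tuple α := ⟨1, fun _ => a⟩

/-- The image of a sequence under a function. -/
abbrev map (f : α → β) (t : Tuple α) : Tuple β := ⟨t.len, fun i => f (t.get i)⟩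

/-- The concatenation `q¹₁, …, q¹_{k₁}, …, qⁿ₁, …, qⁿ_{kₙ}` of finitely many sequences; a position
is identified with a pair `(i, j)` by the lexicographic enumeration `finSigmaFinEquiv`. -/
abbrev concat {n : ℕ} (q : Fin n → Tuple α) : Tuple α :=
  ⟨∑ i, (q i).len, fun x =>
    (q (finSigmaFinEquiv.symm x).1).get (finSigmaFinEquiv.symm x).2⟩

/-- The pair `(i, j)` at which a position of a concatenation is found. -/
def pos {n : ℕ} (q : Fin n → Tuple α) (x : Fin (concat q).len) : Σ i, Fin (q i).len :=
  finSigmaFinEquiv.symm x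

/-- The sequence `(t_{σ(1)}, …, t_{σ(n)})`. -/
abbrev permute (t : Tuple α) (σ : Equiv.Perm (Fin t.len)) : Tuple α :=
  ⟨t.len, fun i => t.get (σ i)⟩

theorem sum_len_perm {n : ℕ} (k : Fin n → ℕ) (σ : Equiv.Perm (Fin n)) :
    ∑ i, k i = ∑ i, k (σ i) := (Equiv.sum_comp σ k).symm

/-- The permutation of `k₁ + ⋯ + kₙ` letters which permutes blocks of lengths `k₁, …, kₙ`
as `σ` does: the `j`-th letter of the `i`-th block of the rearranged list of blocks
(whose lengths are `k_{σ(1)}, …, k_{σ(n)}`) is sent to the `j`-th letter of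
the block with number `σ i`. -/
def blockPerm {n : ℕ} (k : Fin n → ℕ) (σ : Equiv.Perm (Fin n)) :
    Equiv.Perm (Fin (∑ i, k i)) :=
  (finCongr (sum_len_perm k σ)).trans
    ((finSigmaFinEquiv (n := fun i => k (σ i))).symm.trans
      ((Equiv.sigmaCongrLeft (β := fun i => Fin (k i)) σ).trans finSigmaFinEquiv))

/-- The permutation `τ₁ ⊕ ⋯ ⊕ τₙ` of `k₁ + ⋯ + kₙ` letters. -/
def sumPerm {n : ℕ} (k : Fin n → ℕ) (τ : ∀ i, Equiv.Perm (Fin (k i))) :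
    Equiv.Perm (Fin (∑ i, k i)) :=
  (finSigmaFinEquiv (n := k)).symm.trans ((Equiv.sigmaCongrRight τ).trans finSigmaFinEquiv)

theorem ext_get {t s : Tuple α} (h : t.len = s.len)
    (hg : ∀ x : Fin t.len, t.get x = s.get (Fin.cast h x)) : t = s := by
  obtain ⟨n, f⟩ := t
  obtain ⟨m, g⟩ := s
  obtain rfl : n = m := h
  congr 1
  funext x
  exact hg x

/-- The list of the entries. -/
def toList (t : Tuple α) : List α := List.ofFn t.get

theorem toList_injective : Function.Injective (toList : Tuple α → List α) := by
  intro t s h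
  have hl : t.len = s.len := by simpa [toList] using congrArg List.length h
  refine ext_get hl fun x => ?_
  have := List.getElem_of_eq h (i := x.1) (by simp [toList])
  simp only [toList, List.getElem_ofFn] at this
  exact this

theorem get_concat {n : ℕ} (q : Fin n → Tuple α) (i : Fin n) (j : Fin (q i).len) :
    (concat q).get (finSigmaFinEquiv ⟨i, j⟩) = (q i).get j := by
  simp only []
  rw [Equiv.symm_apply_apply]

theorem concat_eq {n : ℕ} (q : Fin n → Tuple α) (t : Tuple α) (hl : (concat q).len = t.len)
    (hg : ∀ i (j : Fin (q i).len), ∃ z : Fin t.len,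
      z.1 = (finSigmaFinEquiv ⟨i, j⟩ : Fin (∑ i, (q i).len)).1 ∧ t.get z = (q i).get j) :
    concat q = t := by
  refine ext_get hl fun x => ?_
  obtain ⟨⟨i, j⟩, rfl⟩ := (finSigmaFinEquiv (n := fun i => (q i).len)).surjective x
  obtain ⟨z, hz, hg⟩ := hg i j
  rw [get_concat, ← hg]
  congr 1
  exact Fin.ext hz

theorem toList_concat {n : ℕ} (q : Fin n → Tuple α) :
    (concat q).toList = (List.ofFn fun i => (q i).toList).flatten := by
  induction n with
  | zero => simp [toList, concat]
  | succ n ih =>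
    have h : concat q = ⟨(concat fun i : Fin n => q i.castSucc).len + (q (Fin.last n)).len,
        Fin.append (concat fun i : Fin n => q i.castSucc).get (q (Fin.last n)).get⟩ := by
      refine concat_eq _ _ (by simp [Fin.sum_univ_castSucc]) ?_
      intro i
      induction i using Fin.lastCases with
      | last =>
        intro j
        refine ⟨Fin.natAdd _ j, ?_, by simp⟩
        rw [finSigmaFinEquiv_apply]
        simp only [Fin.val_natAdd]
        rfl
      | cast i =>
        intro j
        refine ⟨Fin.castAdd _ (finSigmaFinEquiv
          (n := fun i : Fin n => (q i.castSucc).len) ⟨i, j⟩), ?_, ?_⟩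
        · exact (finSigmaFinEquiv_apply _).trans
            (finSigmaFinEquiv_apply (n := fun i => (q i).len) ⟨i.castSucc, j⟩).symm
        · exact (Fin.append_left _ _ _).trans (get_concat (fun i : Fin n => q i.castSucc) i j)
    rw [h, List.ofFn_succ', List.concat_eq_append, List.flatten_append, ← ih]
    simp [toList, List.ofFn_fin_append]

theorem ofFn_pos {n : ℕ} (q : Fin n → Tuple α) (g : (Σ i, Fin (q i).len) → β) :
    (List.ofFn fun x => g (pos q x))
      = (List.ofFn fun i => List.ofFn fun j => g ⟨i, j⟩).flatten :=
  toList_concat (fun i => (⟨(q i).len, fun j => g ⟨i, j⟩⟩ : Tuple β))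

theorem concat_one (t : Tuple α) : concat (fun _ : Fin 1 => t) = t :=
  toList_injective (by simp [toList_concat])

theorem concat_single (t : Tuple α) : concat (fun i => single (t.get i)) = t :=
  toList_injective (by
    rw [toList_concat]
    simp only [toList, single, List.ofFn_succ, List.ofFn_zero]
    rw [← List.flatMap_singleton' (List.ofFn t.get), List.flatMap, List.map_ofFn]
    rfl)

theorem concat_concat {n : ℕ} (q : Fin n → Tuple α)
    (s : ∀ i, Fin (q i).len → Tuple α) :
    concat (fun x => s (pos q x).1 (pos q x).2) = concat (fun i => concat (s i)) :=
  toList_injective (by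
    rw [toList_concat, toList_concat]
    rw [ofFn_pos q (fun y => (s y.1 y.2).toList), List.flatten_flatten, List.map_ofFn]
    congr 2
    funext i
    exact (toList_concat (s i)).symm)

theorem concat_perm {n : ℕ} (q : Fin n → Tuple α) (σ : Equiv.Perm (Fin n)) :
    (concat q).permute (blockPerm (fun i => (q i).len) σ) = concat (fun i => q (σ i)) :=
  ext_get (sum_len_perm (fun i => (q i).len) σ) fun _ => get_concat q _ _

theorem concat_permute {n : ℕ} (q : Fin n → Tuple α)
    (τ : ∀ i, Equiv.Perm (Fin (q i).len)) :
    (concat q).permute (sumPerm (fun i => (q i).len) τ) =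
      concat (fun i => (q i).permute (τ i)) :=
  ext_get rfl fun _ => get_concat q _ _

end Tuple

/-- Transport of a morphism along an equality of the sequences of inputs. -/
def castDom {α : Type u} {H : Tuple α → α → Type u} {p q : Tuple α} {a : α} (h : p = q)
    (f : H p a) : H q a := h ▸ f

theorem castDom_eq_iff_heq {α : Type u} {H : Tuple α → α → Type u} {p q : Tuple α} {a : α}
    (h : p = q) (f : H p a) (g : H q a) : castDom h f = g ↔ HEq f g := by
  subst h
  exact heq_iff_eq.symm

theorem castDom_heq {α : Type u} {H : Tuple α → α → Type u} {p q : Tuple α} {a : α}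
    (h : p = q) (f : H p a) : HEq (castDom h f) f := by
  subst h
  rfl

/-! ### Non-symmetric operads -/

/-- A (small) non-symmetric operad, also called multicategory: `Hom p a` is the set of morphisms
`p₁, …, pₙ → a`, and `comp ψ φ` is the composite `ψ ∘ (φ₁, …, φₙ)`. -/
structure Ope : Type (u + 1) where
  Ob : Type u
  Hom : Tuple Ob → Ob → Type u
  id : ∀ a : Ob, Hom (Tuple.single a) a
  comp : ∀ {p : Tuple Ob} {a : Ob} {q : Fin p.len → Tuple Ob},
    Hom p a → (∀ i, Hom (q i) (p.get i)) → Hom (Tuple.concat q) a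
  id_comp : ∀ {p : Tuple Ob} {a : Ob} (ψ : Hom p a),
    castDom (H := Hom) (Tuple.concat_one p) (comp (id a) (fun _ => ψ)) = ψ
  comp_id : ∀ {p : Tuple Ob} {a : Ob} (ψ : Hom p a),
    castDom (H := Hom) (Tuple.concat_single p) (comp ψ (fun i => id (p.get i))) = ψ
  assoc : ∀ {p : Tuple Ob} {a : Ob} {q : Fin p.len → Tuple Ob}
    {s : ∀ i, Fin (q i).len → Tuple Ob} (ψ : Hom p a) (φ : ∀ i, Hom (q i) (p.get i))
    (χ : ∀ i j, Hom (s i j) ((q i).get j)),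
    castDom (H := Hom) (Tuple.concat_concat q s)
        (comp (comp ψ φ) (fun x => χ (Tuple.pos q x).1 (Tuple.pos q x).2)) =
      comp ψ (fun i => comp (φ i) (χ i))

namespace Ope

/-- A functor between operads. -/
@[ext]
structure Functor (P Q : Ope.{u}) : Type u where
  obj : P.Ob → Q.Ob
  map : ∀ {p : Tuple P.Ob} {a : P.Ob}, P.Hom p a → Q.Hom (p.map obj) (obj a)
  map_id : ∀ a : P.Ob, map (P.id a) = Q.id (obj a)
  map_comp : ∀ {p : Tuple P.Ob} {a : P.Ob} {q : Fin p.len → Tuple P.Ob} (ψ : P.Hom p a)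
    (φ : ∀ i, P.Hom (q i) (p.get i)),
    map (P.comp ψ φ) =
      Q.comp (p := p.map obj) (q := fun i => (q i).map obj) (map ψ) (fun i => map (φ i))

/-- The category `Ope` of small non-symmetric operads. -/
instance : Category.{u} Ope.{u} where
  Hom P Q := Functor P Q
  id P :=
    { obj := fun a => a
      map := fun ψ => ψ
      map_id := fun _ => rfl
      map_comp := fun _ _ => rfl }
  comp F G :=
    { obj := fun a => G.obj (F.obj a)
      map := fun ψ => G.map (F.map ψ)
      map_id := fun a => (congrArg G.map (F.map_id a)).trans (G.map_id _)
      map_comp := fun ψ φ => (congrArg G.map (F.map_comp ψ φ)).trans (G.map_comp _ _) }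

/-- The underlying category `j^* P` of an operad: the same objects, and the unary morphisms. -/
def Underlying (P : Ope.{u}) : Type u := P.Ob

theorem comp_heq (P : Ope.{u}) {p p' : Tuple P.Ob} {a : P.Ob} {q : Fin p.len → Tuple P.Ob}
    {q' : Fin p'.len → Tuple P.Ob} {ψ : P.Hom p a} {ψ' : P.Hom p' a}
    {φ : ∀ i, P.Hom (q i) (p.get i)} {φ' : ∀ i, P.Hom (q' i) (p'.get i)}
    (hp : p = p') (hψ : HEq ψ ψ') (hq : HEq q q') (hφ : HEq φ φ') :
    HEq (P.comp ψ φ) (P.comp ψ' φ') := by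
  subst hp
  obtain rfl := eq_of_heq hψ
  obtain rfl := eq_of_heq hq
  obtain rfl := eq_of_heq hφ
  rfl

/-- Composition of unary morphisms (in the order of composition of maps). -/
def comp₁ (P : Ope.{u}) {a b c : P.Ob} (g : P.Hom (Tuple.single b) c)
    (f : P.Hom (Tuple.single a) b) : P.Hom (Tuple.single a) c :=
  castDom (H := P.Hom) (Tuple.concat_one (Tuple.single a))
    (P.comp (p := Tuple.single b) (q := fun _ => Tuple.single a) g (fun _ => f))

theorem comp₁_heq (P : Ope.{u}) {a b c : P.Ob} (g : P.Hom (Tuple.single b) c)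
    (f : P.Hom (Tuple.single a) b) :
    HEq (P.comp₁ g f)
      (P.comp (p := Tuple.single b) (q := fun _ => Tuple.single a) g (fun _ => f)) :=
  castDom_heq _ _

theorem comp₁_assoc (P : Ope.{u}) {a b c d : P.Ob} (h : P.Hom (Tuple.single c) d)
    (g : P.Hom (Tuple.single b) c) (f : P.Hom (Tuple.single a) b) :
    P.comp₁ (P.comp₁ h g) f = P.comp₁ h (P.comp₁ g f) := by
  have key := (castDom_eq_iff_heq _ _ _).1
    (P.assoc (p := Tuple.single c) (q := fun _ => Tuple.single b)
      (s := fun _ _ => Tuple.single a) h (fun _ => g) (fun _ _ => f))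
  refine eq_of_heq ((castDom_heq _ _).trans (HEq.trans ?_ (castDom_heq _ _).symm))
  refine HEq.trans ?_ (key.trans ?_)
  · exact P.comp_heq (Tuple.concat_one (Tuple.single b)).symm (castDom_heq _ _) HEq.rfl HEq.rfl
  · refine P.comp_heq rfl HEq.rfl ?_ ?_
    · exact heq_of_eq (funext fun _ => Tuple.concat_one (Tuple.single a))
    · exact Function.hfunext rfl fun _ _ _ => (castDom_heq _ _).symm

instance (P : Ope.{u}) : Category.{u} P.Underlying where
  Hom a b := P.Hom (Tuple.single a) b
  id a := P.id a
  comp f g := P.comp₁ g f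
  id_comp f := P.comp_id f
  comp_id f := P.id_comp f
  assoc f g h := (P.comp₁_assoc h g f).symm

/-- The functor `j^* F` between the underlying categories. -/
def underlyingFunctor {P Q : Ope.{u}} (F : P ⟶ Q) : P.Underlying ⥤ Q.Underlying where
  obj a := F.obj a
  map f := F.map f
  map_id a := F.map_id a
  map_comp {a b c} f g := by
    have h : ∀ {p q : Tuple P.Ob} {x : P.Ob} (e : p = q) (ψ : P.Hom p x),
        HEq (F.map (castDom (H := P.Hom) e ψ)) (F.map ψ) := by
      intro p q x e ψ
      subst e
      rfl
    have e : F.map (P.comp (p := Tuple.single b) (q := fun _ => Tuple.single a) g (fun _ => f)) =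
        Q.comp (p := Tuple.single (F.obj b)) (q := fun _ => Tuple.single (F.obj a))
          (F.map g) (fun _ => F.map f) :=
      F.map_comp (p := Tuple.single b) (q := fun _ => Tuple.single a) g (fun _ => f)
    have e' : HEq (F.map (P.comp₁ g f)) (Q.comp₁ (a := F.obj a) (b := F.obj b) (c := F.obj c)
          (F.map g) (F.map f)) :=
      (h _ _).trans ((heq_of_eq e).trans (Q.comp₁_heq (a := F.obj a) (b := F.obj b)
        (c := F.obj c) (F.map g) (F.map f)).symm)
    exact eq_of_heq e'

/-- Operadic equivalences: `j^* F` is essentially surjective, and every component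
`P(p₁, …, pₙ; a) → Q(F p₁, …, F pₙ; F a)` is a bijection. -/
def operadicEquivalences : MorphismProperty Ope.{u} := fun P _ F =>
  (underlyingFunctor F).EssSurj ∧
    ∀ (p : Tuple P.Ob) (a : P.Ob), Function.Bijective (F.map : P.Hom p a → _)

/-- The functors that are injective on objects. -/
def injectiveOnObjects : MorphismProperty Ope.{u} := fun _ _ F => Function.Injective F.obj

/-- The isofibrations: every isomorphism `ψ : F a ⟶ b` lifts to an isomorphism `φ : a ⟶ a'`
with `F a' = b` and `F φ = ψ`. -/
def isofibrations : MorphismProperty Ope.{u} := fun P Q F =>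
  ∀ (a : P.Underlying) (b : Q.Underlying) (ψ : (underlyingFunctor F).obj a ≅ b),
    ∃ (a' : P.Underlying) (φ : a ≅ a') (h : (underlyingFunctor F).obj a' = b),
      (underlyingFunctor F).map φ.hom ≫ eqToHom h = ψ.hom

end Ope

/-! ### Symmetric operads -/

/-- A (small) symmetric operad: `act σ` is the function
`σ^* : P(p₁, …, pₙ; a) → P(p_{σ(1)}, …, p_{σ(n)}; a)`. -/
structure SymOpe : Type (u + 1) extends Ope.{u} where
  act : ∀ {p : Tuple Ob} {a : Ob} (σ : Equiv.Perm (Fin p.len)), Hom p a → Hom (p.permute σ) a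
  act_one : ∀ {p : Tuple Ob} {a : Ob} (ψ : Hom p a), act 1 ψ = ψ
  act_mul : ∀ {p : Tuple Ob} {a : Ob} (σ τ : Equiv.Perm (Fin p.len)) (ψ : Hom p a),
    act (σ * τ) ψ = act (p := p.permute σ) τ (act σ ψ)
  act_comp : ∀ {p : Tuple Ob} {a : Ob} {q : Fin p.len → Tuple Ob}
    (σ : Equiv.Perm (Fin p.len)) (ψ : Hom p a) (φ : ∀ i, Hom (q i) (p.get i)),
    comp (p := p.permute σ) (q := fun i => q (σ i)) (act σ ψ) (fun i => φ (σ i)) =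
      castDom (H := Hom) (Tuple.concat_perm q σ)
        (act (Tuple.blockPerm (fun i => (q i).len) σ) (comp ψ φ))
  comp_act : ∀ {p : Tuple Ob} {a : Ob} {q : Fin p.len → Tuple Ob}
    (τ : ∀ i, Equiv.Perm (Fin (q i).len)) (ψ : Hom p a) (φ : ∀ i, Hom (q i) (p.get i)),
    comp ψ (fun i => act (τ i) (φ i)) =
      castDom (H := Hom) (Tuple.concat_permute q τ)
        (act (Tuple.sumPerm (fun i => (q i).len) τ) (comp ψ φ))

namespace SymOpe

/-- A functor between symmetric operads: it also respects the actions of the symmetric groups. -/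
@[ext]
structure Functor (P Q : SymOpe.{u}) : Type u extends Ope.Functor P.toOpe Q.toOpe where
  map_act : ∀ {p : Tuple P.Ob} {a : P.Ob} (σ : Equiv.Perm (Fin p.len)) (ψ : P.Hom p a),
    map (P.act σ ψ) = Q.act (p := p.map obj) σ (map ψ)

/-- The category `Ope_Σ` of small symmetric operads. -/
instance : Category.{u} SymOpe.{u} where
  Hom P Q := Functor P Q
  id P :=
    { toFunctor := 𝟙 P.toOpe
      map_act := fun _ _ => rfl }
  comp {P Q R} F G :=
    { toFunctor := (show P.toOpe ⟶ Q.toOpe from F.toFunctor) ≫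
        (show Q.toOpe ⟶ R.toOpe from G.toFunctor)
      map_act := fun σ ψ => (congrArg G.map (F.map_act σ ψ)).trans (G.map_act _ _) }

/-- The functor forgetting the actions of the symmetric groups. -/
def forget : SymOpe.{u} ⥤ Ope.{u} where
  obj P := P.toOpe
  map F := F.toFunctor

/-- Operadic equivalences of symmetric operads. -/
def operadicEquivalences : MorphismProperty SymOpe.{u} :=
  Ope.operadicEquivalences.inverseImage forget

/-- The functors of symmetric operads that are injective on objects. -/
def injectiveOnObjects : MorphismProperty SymOpe.{u} :=
  Ope.injectiveOnObjects.inverseImage forget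

/-- The isofibrations of symmetric operads. -/
def isofibrations : MorphismProperty SymOpe.{u} :=
  Ope.isofibrations.inverseImage forget

end SymOpe

/-!
The category of operads behaves like the category of small categories with its canonical model
structure; multimorphisms enter only through their composites with unary ones.

*Limits* are computed componentwise on objects and on morphisms. For *colimits*, the objects are the
colimit of the sets of objects, and the morphisms are formal composites of morphisms of the diagram,
two of which are identified if they have the same value in every cocone. Equations between such
morphisms are then checked in the cocones (`Ope.ColimitHom.ext`), so that the laws of an operad
and the universal property are immediate; no explicit description of the relations is
needed. The same construction, with formal rearrangements of inputs added, serves symmetric operads.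

*The model structure.* Two constructions carry the proof. First, a functor lifts through a fully
faithful functor as soon as it does so on objects (`Ope.FullyFaithful.exists_lift`). Second, the
values `G b` of a functor `G` can be replaced by isomorphic objects, `G` being conjugated by the
isomorphisms (`Ope.conj`). Functors which are injective on objects lift against trivial fibrations,
which are the fully faithful functors surjective on objects, by the first construction. A trivial
cofibration `i` has a retraction `r` with an isomorphism from `r ≫ i` to the identity relative to
the image of `i`; a lift against an isofibration is a conjugate of `r ≫ f`, where `f` is the given
functor on the source of `i` (`Ope.hasLiftingProperty_isofibration`). The two factorizations of a
functor `F : P ⟶ Q` use the operads with objects `P ⊔ Q` and with objects the isomorphisms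
`F x ≅ y`, whose morphisms are pulled back from `Q` and from `P`.

For symmetric operads the same functors are used: a functor is equivariant if its composite with an
equivariant fully faithful functor, or its restriction along an equivariant equivalence, is
(`SymOpe.IsEquivariant.of_comp_right`, `SymOpe.IsEquivariant.of_comp_left`).
-/

/-! ### Positions in concatenations -/

namespace Tuple

theorem pos_snd_val_of_one {α : Type u} (t : Tuple α)
    (x : Fin (concat (fun _ : Fin 1 => t)).len) : (pos (fun _ : Fin 1 => t) x).2.1 = x.1 := by
  obtain ⟨⟨i, j⟩, rfl⟩ := (finSigmaFinEquiv (n := fun _ : Fin 1 => t.len)).surjective x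
  obtain rfl := Subsingleton.elim i 0
  simp [pos, finSigmaFinEquiv_apply]

theorem pos_fst_val_of_single {α : Type u} {n : ℕ} (r : Fin n → α)
    (x : Fin (concat (fun i => single (r i))).len) :
    (pos (fun i => single (r i)) x).1.1 = x.1 := by
  obtain ⟨⟨i, j⟩, rfl⟩ := (finSigmaFinEquiv (n := fun _ : Fin n => 1)).surjective x
  obtain rfl := Subsingleton.elim j 0
  simp [pos, finSigmaFinEquiv_apply]

theorem blockPerm_apply {n : ℕ} (k : Fin n → ℕ) (σ : Equiv.Perm (Fin n)) (i : Fin n)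
    (j : Fin (k (σ i))) :
    blockPerm k σ (Fin.cast (sum_len_perm k σ).symm
      (finSigmaFinEquiv (n := fun i => k (σ i)) ⟨i, j⟩)) = finSigmaFinEquiv ⟨σ i, j⟩ := by
  simp only [blockPerm, Equiv.trans_apply, finCongr_apply, Fin.cast_cast, Fin.cast_eq_self]
  rw [Equiv.symm_apply_apply]
  rfl

theorem perm_heq {n m : ℕ} (h : n = m) {σ : Equiv.Perm (Fin n)} {τ : Equiv.Perm (Fin m)}
    (hστ : ∀ x, (σ x).1 = (τ (Fin.cast h x)).1) : HEq σ τ := by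
  subst h
  exact heq_of_eq (Equiv.ext fun x => Fin.ext (hστ x))

/-- Permuting blocks of length one is permuting letters. -/
theorem blockPerm_one_heq {n : ℕ} (σ : Equiv.Perm (Fin n)) :
    HEq (blockPerm (fun _ => 1) σ) σ := by
  refine perm_heq (by simp) fun x => ?_
  obtain ⟨x, rfl⟩ := (finCongr (sum_len_perm (fun _ => 1) σ).symm).surjective x
  obtain ⟨⟨i, j⟩, rfl⟩ := (finSigmaFinEquiv (n := fun _ : Fin n => 1)).surjective x
  obtain rfl := Subsingleton.elim j 0
  refine (congrArg Fin.val (blockPerm_apply (fun _ => 1) σ i 0)).trans ?_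
  have e : ∀ i : Fin n, (finSigmaFinEquiv (n := fun _ : Fin n => 1) ⟨i, 0⟩).1 = i.1 := by
    intro i
    simp [finSigmaFinEquiv_apply]
  rw [e]
  congr 2
  exact Fin.ext (e i).symm

/-- The sum of a single permutation is this permutation. -/
theorem sumPerm_one_heq {n : ℕ} (σ : Equiv.Perm (Fin n)) :
    HEq (sumPerm (fun _ : Fin 1 => n) (fun _ => σ)) σ := by
  refine perm_heq (by simp) fun x => ?_
  obtain ⟨⟨i, j⟩, rfl⟩ := (finSigmaFinEquiv (n := fun _ : Fin 1 => n)).surjective x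
  obtain rfl := Subsingleton.elim i 0
  have e : ∀ j : Fin n, (finSigmaFinEquiv (n := fun _ : Fin 1 => n) ⟨0, j⟩).1 = j.1 := by
    intro j
    simp [finSigmaFinEquiv_apply]
  simp only [sumPerm, Equiv.trans_apply, Equiv.symm_apply_apply]
  refine (e (σ j)).trans ?_
  congr 2
  exact Fin.ext (e j).symm

end Tuple

namespace Ope

/-! ### Equality of morphisms and of functors -/

theorem comp_apply_heq (P : Ope.{u}) {p p' : Tuple P.Ob} {a a' : P.Ob}
    {q : Fin p.len → Tuple P.Ob} {q' : Fin p'.len → Tuple P.Ob} {ψ : P.Hom p a} {ψ' : P.Hom p' a'}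
    {φ : ∀ i, P.Hom (q i) (p.get i)} {φ' : ∀ i, P.Hom (q' i) (p'.get i)}
    (hp : p = p') (ha : a = a') (hψ : HEq ψ ψ')
    (hq : ∀ i j, i.1 = j.1 → q i = q' j) (hφ : ∀ i j, i.1 = j.1 → HEq (φ i) (φ' j)) :
    HEq (P.comp ψ φ) (P.comp ψ' φ') := by
  subst hp ha
  obtain rfl : q = q' := funext fun i => hq i i rfl
  obtain rfl : φ = φ' := funext fun i => eq_of_heq (hφ i i rfl)
  obtain rfl := eq_of_heq hψ
  rfl

variable {P Q R : Ope.{u}}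

theorem map_castDom (F : P ⟶ Q) {p q : Tuple P.Ob} {a : P.Ob} (h : p = q) (ψ : P.Hom p a) :
    F.map (castDom (H := P.Hom) h ψ) =
      castDom (H := Q.Hom) (congrArg (Tuple.map F.obj) h) (F.map ψ) := by
  subst h
  rfl

theorem map_heq (F : P ⟶ Q) {p q : Tuple P.Ob} {a b : P.Ob} (hp : p = q) (ha : a = b)
    {ψ : P.Hom p a} {φ : P.Hom q b} (h : HEq ψ φ) : HEq (F.map ψ) (F.map φ) := by
  subst hp ha
  obtain rfl := eq_of_heq h
  rfl

/-- Functors agree if they agree on objects and on morphisms. -/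
theorem hom_ext {F G : P ⟶ Q} (ho : ∀ a, F.obj a = G.obj a)
    (hm : ∀ {p : Tuple P.Ob} {a : P.Ob} (ψ : P.Hom p a), HEq (F.map ψ) (G.map ψ)) : F = G := by
  obtain ⟨o, m, _, _⟩ := F
  obtain ⟨o', m', _, _⟩ := G
  obtain rfl : o = o' := funext ho
  obtain rfl : @m = @m' := by
    funext p a ψ
    exact eq_of_heq (hm ψ)
  rfl

theorem congr_map {F G : P ⟶ Q} (h : F = G) {p : Tuple P.Ob} {a : P.Ob} (ψ : P.Hom p a) :
    HEq (F.map ψ) (G.map ψ) := by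
  subst h
  rfl

theorem congr_obj {F G : P ⟶ Q} (h : F = G) (a : P.Ob) : F.obj a = G.obj a := by
  subst h
  rfl

/-! ### Composition with unary morphisms -/

/-- The composite of a morphism with a unary morphism out of its target. -/
def post (P : Ope.{u}) {p : Tuple P.Ob} {a b : P.Ob} (g : P.Hom (Tuple.single a) b)
    (ψ : P.Hom p a) : P.Hom p b :=
  castDom (H := P.Hom) (Tuple.concat_one p)
    (P.comp (p := Tuple.single a) (q := fun _ => p) g (fun _ => ψ))

/-- The composite of a morphism with unary morphisms into its inputs. -/
def pre (P : Ope.{u}) {p : Tuple P.Ob} {a : P.Ob} {r : Fin p.len → P.Ob} (ψ : P.Hom p a)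
    (f : ∀ i, P.Hom (Tuple.single (r i)) (p.get i)) : P.Hom ⟨p.len, r⟩ a :=
  castDom (H := P.Hom) (Tuple.concat_single ⟨p.len, r⟩)
    (P.comp (q := fun i => Tuple.single (r i)) ψ f)

theorem post_castDom {p q : Tuple P.Ob} {a b : P.Ob} (h : p = q) (g : P.Hom (Tuple.single a) b)
    (ψ : P.Hom p a) :
    P.post g (castDom (H := P.Hom) h ψ) = castDom (H := P.Hom) h (P.post g ψ) := by
  subst h
  rfl

theorem comp_post {p : Tuple P.Ob} {a b : P.Ob} {q : Fin p.len → Tuple P.Ob}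
    (g : P.Hom (Tuple.single a) b) (ψ : P.Hom p a) (φ : ∀ i, P.Hom (q i) (p.get i)) :
    P.comp (P.post g ψ) φ = P.post g (P.comp ψ φ) := by
  have key := (castDom_eq_iff_heq _ _ _).1
    (P.assoc (p := Tuple.single a) (q := fun _ => p) (s := fun _ j => q j) g (fun _ => ψ)
      (fun _ j => φ j))
  refine eq_of_heq (HEq.trans ?_ (key.trans (castDom_heq _ _).symm))
  refine P.comp_apply_heq (Tuple.concat_one p).symm rfl (castDom_heq _ _) ?_ ?_
  · intro i j h
    congr 1
    exact Fin.ext (h.trans (Tuple.pos_snd_val_of_one p j).symm)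
  · intro i j h
    obtain rfl : i = _ := Fin.ext (h.trans (Tuple.pos_snd_val_of_one p j).symm)
    rfl

theorem comp_pre {p : Tuple P.Ob} {a : P.Ob} {r : Fin p.len → P.Ob} {q : Fin p.len → Tuple P.Ob}
    (ψ : P.Hom p a) (f : ∀ i, P.Hom (Tuple.single (r i)) (p.get i)) (φ : ∀ i, P.Hom (q i) (r i)) :
    P.comp (P.pre ψ f) φ = P.comp ψ (fun i => P.post (f i) (φ i)) := by
  have key := (castDom_eq_iff_heq _ _ _).1
    (P.assoc (q := fun i => Tuple.single (r i)) (s := fun i _ => q i) ψ f (fun i _ => φ i))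
  refine eq_of_heq (HEq.trans ?_ (key.trans ?_))
  · refine P.comp_apply_heq (Tuple.concat_single ⟨p.len, r⟩).symm rfl (castDom_heq _ _) ?_ ?_
    · intro i j h
      congr 1
      exact Fin.ext (h.trans (Tuple.pos_fst_val_of_single r j).symm)
    · intro i j h
      obtain rfl : i = _ := Fin.ext (h.trans (Tuple.pos_fst_val_of_single r j).symm)
      rfl
  · refine P.comp_apply_heq rfl rfl HEq.rfl ?_ ?_
    · intro i j h
      obtain rfl : i = j := Fin.ext h
      exact Tuple.concat_one (q i)
    · intro i j h
      obtain rfl : i = j := Fin.ext h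
      exact (castDom_heq _ _).symm

theorem comp_pre_right {p : Tuple P.Ob} {a : P.Ob} {q : Fin p.len → Tuple P.Ob}
    {r : ∀ i, Fin (q i).len → P.Ob} (ψ : P.Hom p a) (φ : ∀ i, P.Hom (q i) (p.get i))
    (f : ∀ i j, P.Hom (Tuple.single (r i j)) ((q i).get j)) :
    P.comp ψ (fun i => P.pre (φ i) (f i)) =
      P.pre (r := fun x => r (Tuple.pos q x).1 (Tuple.pos q x).2) (P.comp ψ φ)
        (fun x => f (Tuple.pos q x).1 (Tuple.pos q x).2) := by
  have key := (castDom_eq_iff_heq _ _ _).1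
    (P.assoc (s := fun i j => Tuple.single (r i j)) ψ φ f)
  refine eq_of_heq (HEq.trans ?_ (key.symm.trans (castDom_heq _ _).symm))
  refine P.comp_apply_heq rfl rfl HEq.rfl ?_ ?_
  · intro i j h
    obtain rfl : i = j := Fin.ext h
    exact (Tuple.concat_single ⟨(q i).len, r i⟩).symm
  · intro i j h
    obtain rfl : i = j := Fin.ext h
    exact castDom_heq _ _

theorem post_id {p : Tuple P.Ob} {a : P.Ob} (ψ : P.Hom p a) : P.post (P.id a) ψ = ψ :=
  P.id_comp ψ

theorem pre_id {p : Tuple P.Ob} {a : P.Ob} (ψ : P.Hom p a) :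
    P.pre (r := p.get) ψ (fun i => P.id (p.get i)) = ψ :=
  P.comp_id ψ

theorem post_post {p : Tuple P.Ob} {a b c : P.Ob} (g : P.Hom (Tuple.single b) c)
    (h : P.Hom (Tuple.single a) b) (ψ : P.Hom p a) :
    P.post g (P.post h ψ) = P.post (P.post g h) ψ := by
  unfold post
  refine (post_castDom _ g _).trans (congrArg _ ?_)
  exact (comp_post (p := Tuple.single a) (q := fun _ => p) g h (fun _ => ψ)).symm

theorem pre_pre {p : Tuple P.Ob} {a : P.Ob} {r s : Fin p.len → P.Ob}
    (ψ : P.Hom p a) (f : ∀ i, P.Hom (Tuple.single (r i)) (p.get i))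
    (f' : ∀ i, P.Hom (Tuple.single (s i)) (r i)) :
    P.pre (p := ⟨p.len, r⟩) (P.pre ψ f) f' = P.pre ψ (fun i => P.post (f i) (f' i)) :=
  congrArg _ (comp_pre (q := fun i => Tuple.single (s i)) ψ f f')

theorem post_pre {p : Tuple P.Ob} {a b : P.Ob} {r : Fin p.len → P.Ob}
    (g : P.Hom (Tuple.single a) b) (ψ : P.Hom p a)
    (f : ∀ i, P.Hom (Tuple.single (r i)) (p.get i)) :
    P.post g (P.pre ψ f) = P.pre (P.post g ψ) f :=
  (post_castDom _ g _).trans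
    (congrArg _ (comp_post (q := fun i => Tuple.single (r i)) g ψ f).symm)

theorem map_post (F : P ⟶ Q) {p : Tuple P.Ob} {a b : P.Ob} (g : P.Hom (Tuple.single a) b)
    (ψ : P.Hom p a) :
    F.map (P.post g ψ) = Q.post (p := p.map F.obj) (a := F.obj a) (F.map g) (F.map ψ) :=
  (map_castDom F _ _).trans
    (congrArg _ (F.map_comp (p := Tuple.single a) (q := fun _ => p) g (fun _ => ψ)))

theorem map_pre (F : P ⟶ Q) {p : Tuple P.Ob} {a : P.Ob} {r : Fin p.len → P.Ob}
    (ψ : P.Hom p a) (f : ∀ i, P.Hom (Tuple.single (r i)) (p.get i)) :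
    F.map (P.pre ψ f) =
      Q.pre (p := p.map F.obj) (r := fun i => F.obj (r i)) (F.map ψ) (fun i => F.map (f i)) :=
  (map_castDom F _ _).trans
    (congrArg _ (F.map_comp (q := fun i => Tuple.single (r i)) ψ f))

theorem post_hom_inv {a b : P.Underlying} (e : a ≅ b) : P.post e.hom e.inv = P.id b :=
  e.inv_hom_id

theorem post_inv_hom {a b : P.Underlying} (e : a ≅ b) : P.post e.inv e.hom = P.id a :=
  e.hom_inv_id

end Ope

namespace SymOpe

theorem act_heq (P : SymOpe.{u}) {p p' : Tuple P.Ob} {a a' : P.Ob} (hp : p = p') (ha : a = a')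
    {σ : Equiv.Perm (Fin p.len)} {σ' : Equiv.Perm (Fin p'.len)} (hσ : HEq σ σ')
    {ψ : P.Hom p a} {ψ' : P.Hom p' a'} (hψ : HEq ψ ψ') : HEq (P.act σ ψ) (P.act σ' ψ') := by
  subst hp ha
  obtain rfl := eq_of_heq hσ
  obtain rfl := eq_of_heq hψ
  rfl

theorem act_pre (P : SymOpe.{u}) {p : Tuple P.Ob} {a : P.Ob} {r : Fin p.len → P.Ob}
    (σ : Equiv.Perm (Fin p.len)) (ψ : P.Hom p a)
    (f : ∀ i, P.Hom (Tuple.single (r i)) (p.get i)) :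
    P.act (p := ⟨p.len, r⟩) σ (P.pre ψ f) =
      P.pre (p := p.permute σ) (r := fun i => r (σ i)) (P.act σ ψ) (fun i => f (σ i)) := by
  have key := P.act_comp (q := fun i => Tuple.single (r i)) σ ψ f
  refine eq_of_heq (HEq.trans ?_ (castDom_heq _ _).symm)
  refine HEq.trans ?_ (heq_of_eq key.symm)
  refine HEq.trans ?_ (castDom_heq _ _).symm
  exact P.act_heq (Tuple.concat_single ⟨p.len, r⟩).symm rfl (Tuple.blockPerm_one_heq σ).symm
    (castDom_heq _ _)

theorem act_post (P : SymOpe.{u}) {p : Tuple P.Ob} {a b : P.Ob} (σ : Equiv.Perm (Fin p.len))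
    (g : P.Hom (Tuple.single a) b) (ψ : P.Hom p a) :
    P.act σ (P.post g ψ) = P.post g (P.act σ ψ) := by
  have key := P.comp_act (p := Tuple.single a) (q := fun _ => p) (fun _ => σ) g (fun _ => ψ)
  refine eq_of_heq (HEq.trans ?_ (castDom_heq _ _).symm)
  refine HEq.trans ?_ (heq_of_eq key.symm)
  refine HEq.trans ?_ (castDom_heq _ _).symm
  exact P.act_heq (Tuple.concat_one p).symm rfl (Tuple.sumPerm_one_heq σ).symm
    (castDom_heq _ _)

end SymOpe

/-! ### Limits -/

/-- Maps between families of morphisms commute with transport. -/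
theorem castDom_natural {α β : Type u} {H : Tuple α → α → Type u} {K : Tuple β → β → Type u}
    (o : α → β) (η : ∀ {p : Tuple α} {a : α}, H p a → K (p.map o) (o a)) {p q : Tuple α} {a : α}
    (h : p = q) (ψ : H p a) :
    η (castDom (H := H) h ψ) = castDom (H := K) (congrArg (Tuple.map o) h) (η ψ) := by
  subst h
  rfl

namespace Ope

section Limits

variable {J : Type u} [SmallCategory J]

/-- The objects of the limit of a diagram of operads: the compatible families of objects. -/
abbrev LimitOb (F : J ⥤ Ope.{u}) : Type u :=
  {x : ∀ j, (F.obj j).Ob // ∀ {j j'} (f : j ⟶ j'), (F.map f).obj (x j) = x j'}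

/-- The morphisms of the limit of a diagram of operads: the compatible families of morphisms.
Compatibility is a heterogeneous equality, since inputs and targets agree only propositionally. -/
abbrev LimitHom (F : J ⥤ Ope.{u}) (p : Tuple (LimitOb F)) (a : LimitOb F) : Type u :=
  {ψ : ∀ j, (F.obj j).Hom (p.map fun x => x.1 j) (a.1 j) //
    ∀ {j j'} (f : j ⟶ j'), HEq ((F.map f).map (ψ j)) (ψ j')}

theorem id_heq (P : Ope.{u}) {a b : P.Ob} (h : a = b) : HEq (P.id a) (P.id b) := by
  subst h
  rfl

theorem LimitHom.castDom_val (F : J ⥤ Ope.{u}) {p q : Tuple (LimitOb F)} {a : LimitOb F}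
    (h : p = q) (ψ : LimitHom F p a) (j : J) :
    (castDom (H := LimitHom F) h ψ).1 j =
      castDom (H := (F.obj j).Hom) (congrArg (Tuple.map fun x => x.1 j) h) (ψ.1 j) :=
  castDom_natural (H := LimitHom F) (fun x => x.1 j) (fun ψ => ψ.1 j) h ψ

/-- The limit of a diagram of operads. -/
def limitOpe (F : J ⥤ Ope.{u}) : Ope.{u} where
  Ob := LimitOb F
  Hom := LimitHom F
  id a := ⟨fun j => (F.obj j).id (a.1 j), fun {j j'} f =>
    (heq_of_eq ((F.map f).map_id _)).trans (id_heq _ (a.2 f))⟩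
  comp {p a q} ψ φ := ⟨fun j => (F.obj j).comp (p := p.map fun x => x.1 j)
      (q := fun i => (q i).map fun x => x.1 j) (ψ.1 j) (fun i => (φ i).1 j), fun {j j'} f => by
    refine (heq_of_eq ((F.map f).map_comp (p := p.map fun x => x.1 j)
      (q := fun i => (q i).map fun x => x.1 j) (ψ.1 j) (fun i => (φ i).1 j))).trans ?_
    refine comp_apply_heq _ ?_ (a.2 f) (ψ.2 f) ?_ ?_
    · exact Tuple.ext_get rfl fun x => (p.get x).2 f
    · intro i i' h
      obtain rfl : i = i' := Fin.ext h
      exact Tuple.ext_get rfl fun x => ((q i).get x).2 f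
    · intro i i' h
      obtain rfl : i = i' := Fin.ext h
      exact (φ i).2 f⟩
  id_comp ψ := Subtype.ext (funext fun j =>
    (LimitHom.castDom_val F _ _ j).trans ((F.obj j).id_comp _))
  comp_id ψ := Subtype.ext (funext fun j =>
    (LimitHom.castDom_val F _ _ j).trans ((F.obj j).comp_id _))
  assoc ψ φ χ := Subtype.ext (funext fun j =>
    (LimitHom.castDom_val F _ _ j).trans ((F.obj j).assoc (ψ.1 j) (fun i => (φ i).1 j)
      (fun i i' => (χ i i').1 j)))

/-- The projections of the limit. -/
def limitπ (F : J ⥤ Ope.{u}) (j : J) : limitOpe F ⟶ F.obj j where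
  obj x := x.1 j
  map ψ := ψ.1 j
  map_id _ := rfl
  map_comp _ _ := rfl

theorem limitOpe_hom_heq (F : J ⥤ Ope.{u}) {p p' : Tuple (LimitOb F)} {a a' : LimitOb F}
    {ψ : LimitHom F p a} {ψ' : LimitHom F p' a'} (hp : p = p') (ha : a = a')
    (h : ∀ j, HEq (ψ.1 j) (ψ'.1 j)) : HEq ψ ψ' := by
  subst hp ha
  exact heq_of_eq (Subtype.ext (funext fun j => eq_of_heq (h j)))

/-- The cone exhibiting `limitOpe F` as a limit. -/
def limitCone (F : J ⥤ Ope.{u}) : Cone F where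
  pt := limitOpe F
  π :=
    { app := limitπ F
      naturality := fun _ _ f => hom_ext (fun x => (x.2 f).symm) (fun ψ => (ψ.2 f).symm) }

/-- The functor into the limit given by a cone. -/
def limitLift (F : J ⥤ Ope.{u}) (c : Cone F) : c.pt ⟶ limitOpe F where
  obj x := ⟨fun j => (c.π.app j).obj x, fun f => congr_obj (c.w f) x⟩
  map ψ := ⟨fun j => (c.π.app j).map ψ, fun f => congr_map (c.w f) ψ⟩
  map_id a := Subtype.ext (funext fun j => (c.π.app j).map_id a)
  map_comp ψ φ := Subtype.ext (funext fun j => (c.π.app j).map_comp ψ φ)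

theorem limit_hom_ext (F : J ⥤ Ope.{u}) {P : Ope.{u}} {G G' : P ⟶ limitOpe F}
    (h : ∀ j, G ≫ limitπ F j = G' ≫ limitπ F j) : G = G' := by
  have ho : ∀ a, G.obj a = G'.obj a := fun a => Subtype.ext (funext fun j => congr_obj (h j) a)
  exact hom_ext ho fun ψ => limitOpe_hom_heq F (Tuple.ext_get rfl fun _ => ho _) (ho _)
    fun j => congr_map (h j) ψ

/-- `limitCone F` is a limit cone. -/
def isLimitLimitCone (F : J ⥤ Ope.{u}) : IsLimit (limitCone F) where
  lift := limitLift F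
  fac _ _ := rfl
  uniq _ _ h := limit_hom_ext F fun j => h j

end Limits

theorem hasLimits : HasLimits Ope.{u} where
  has_limits_of_shape _ _ := ⟨fun F => ⟨⟨⟨limitCone F, isLimitLimitCone F⟩⟩⟩⟩

end Ope

namespace SymOpe

theorem hom_ext {P Q : SymOpe.{u}} {F G : P ⟶ Q} (h : forget.map F = forget.map G) : F = G := by
  obtain ⟨F, _⟩ := F
  obtain ⟨G, _⟩ := G
  obtain rfl : F = G := h
  rfl

section Limits

variable {J : Type u} [SmallCategory J]

/-- The component of an object of the limit. -/
abbrev limitEval (F : J ⥤ SymOpe.{u}) (j : J) (x : Ope.LimitOb (F ⋙ forget)) : (F.obj j).Ob :=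
  x.1 j

/-- The limit of a diagram of symmetric operads: the symmetric groups act componentwise on
the limit of the underlying operads. -/
def limitSymOpe (F : J ⥤ SymOpe.{u}) : SymOpe.{u} where
  toOpe := Ope.limitOpe (F ⋙ forget)
  act {p a} σ ψ := ⟨fun j =>
      (F.obj j).act (p := p.map (limitEval F j)) (a := limitEval F j a) σ (ψ.1 j),
    fun {j j'} f => by
      refine (heq_of_eq ((F.map f).map_act (p := p.map (limitEval F j)) (a := limitEval F j a)
        σ (ψ.1 j))).trans ?_
      have e : (p.map (limitEval F j)).map (F.map f).obj = p.map (limitEval F j') :=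
        Tuple.ext_get rfl fun x => (p.get x).2 f
      exact (F.obj j').act_heq e (a.2 f) HEq.rfl (ψ.2 f)⟩
  act_one ψ := Subtype.ext (funext fun j => (F.obj j).act_one _)
  act_mul {p a} σ τ ψ := Subtype.ext (funext fun j =>
    (F.obj j).act_mul (p := p.map (limitEval F j)) (a := limitEval F j a) σ τ (ψ.1 j))
  act_comp {p a q} σ ψ φ := Subtype.ext (funext fun j => by
    refine Eq.trans ?_ (Ope.LimitHom.castDom_val (F ⋙ forget) (Tuple.concat_perm q σ) _ j).symm
    exact (F.obj j).act_comp (p := p.map (limitEval F j)) (a := limitEval F j a)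
      (q := fun i => (q i).map (limitEval F j)) σ (ψ.1 j) (fun i => (φ i).1 j))
  comp_act {p a q} τ ψ φ := Subtype.ext (funext fun j => by
    refine Eq.trans ?_ (Ope.LimitHom.castDom_val (F ⋙ forget) (Tuple.concat_permute q τ) _ j).symm
    exact (F.obj j).comp_act (p := p.map (limitEval F j)) (a := limitEval F j a)
      (q := fun i => (q i).map (limitEval F j)) τ (ψ.1 j) (fun i => (φ i).1 j))

/-- The cone exhibiting `limitSymOpe F` as a limit. -/
def limitCone (F : J ⥤ SymOpe.{u}) : Cone F where
  pt := limitSymOpe F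
  π :=
    { app := fun j =>
        { toFunctor := Ope.limitπ (F ⋙ forget) j
          map_act := fun _ _ => rfl }
      naturality := fun _ _ f => hom_ext ((Ope.limitCone (F ⋙ forget)).π.naturality f) }

/-- `limitCone F` is a limit cone. -/
def isLimitLimitCone (F : J ⥤ SymOpe.{u}) : IsLimit (limitCone F) where
  lift c :=
    { toFunctor := Ope.limitLift (F ⋙ forget) (forget.mapCone c)
      map_act := fun σ ψ => Subtype.ext (funext fun j => (c.π.app j).map_act σ ψ) }
  fac _ _ := rfl
  uniq _ _ h := hom_ext (Ope.limit_hom_ext (F ⋙ forget) fun j => congrArg forget.map (h j))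

end Limits

theorem hasLimits : HasLimits SymOpe.{u} where
  has_limits_of_shape _ _ := ⟨fun F => ⟨⟨⟨limitCone F, isLimitLimitCone F⟩⟩⟩⟩

end SymOpe

/-! ### Colimits -/

namespace Ope

section Colimits

variable {J : Type u} [SmallCategory J]

/-- The objects of the colimit of a diagram of operads: the colimit of the sets of objects. -/
def ColimitOb (F : J ⥤ Ope.{u}) : Type u :=
  Quot fun x y : Σ j, (F.obj j).Ob => ∃ f : x.1 ⟶ y.1, (F.map f).obj x.2 = y.2

/-- The map from the objects of an operad of the diagram to those of the colimit. -/
abbrev ColimitOb.mk (F : J ⥤ Ope.{u}) (j : J) (a : (F.obj j).Ob) : ColimitOb F := Quot.mk _ ⟨j, a⟩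

/-- The leg of a cocone at an index. -/
abbrev leg {F : J ⥤ Ope.{u}} (c : Cocone F) (j : J) : F.obj j ⟶ c.pt := c.ι.app j

/-- The map which a cocone induces on the objects of the colimit. -/
def ColimitOb.desc {F : J ⥤ Ope.{u}} (c : Cocone F) : ColimitOb F → c.pt.Ob :=
  Quot.lift (fun x => (leg c x.1).obj x.2) (by
    rintro ⟨j, a⟩ ⟨j', a'⟩ ⟨f, h : (F.map f).obj a = a'⟩
    exact (congr_obj (c.w f) a).symm.trans (congrArg (leg c j').obj h))

/-- Formal expressions for the morphisms of the colimit, with the given inputs and target.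
Rearrangements of the inputs are allowed if the proposition `s` holds: it is false in the colimit
of non-symmetric operads and true in that of symmetric ones. -/
inductive ColimitTerm (F : J ⥤ Ope.{u}) (s : Prop) : Tuple (ColimitOb F) → ColimitOb F → Type u
  | of (j : J) {p : Tuple (F.obj j).Ob} {a : (F.obj j).Ob} (ψ : (F.obj j).Hom p a) :
      ColimitTerm F s (p.map (ColimitOb.mk F j)) (ColimitOb.mk F j a)
  | id (a : ColimitOb F) : ColimitTerm F s (Tuple.single a) a
  | comp {p : Tuple (ColimitOb F)} {a : ColimitOb F} {q : Fin p.len → Tuple (ColimitOb F)}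
      (t : ColimitTerm F s p a) (t' : ∀ i, ColimitTerm F s (q i) (p.get i)) :
      ColimitTerm F s (Tuple.concat q) a
  | act (h : s) {p : Tuple (ColimitOb F)} {a : ColimitOb F} (σ : Equiv.Perm (Fin p.len))
      (t : ColimitTerm F s p a) : ColimitTerm F s (p.permute σ) a

/-- Rearrangements of the inputs of the morphisms of an operad, without any laws. -/
abbrev Rearrangement (P : Ope.{u}) : Type u :=
  ∀ {p : Tuple P.Ob} {a : P.Ob} (σ : Equiv.Perm (Fin p.len)), P.Hom p a → P.Hom (p.permute σ) a

/-- The value of an expression in a cocone. -/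
def ColimitTerm.eval {F : J ⥤ Ope.{u}} {s : Prop} (c : Cocone F) (α : s → Rearrangement c.pt) :
    ∀ {p : Tuple (ColimitOb F)} {a : ColimitOb F}, ColimitTerm F s p a →
      c.pt.Hom (p.map (ColimitOb.desc c)) (ColimitOb.desc c a)
  | _, _, .of j ψ => (leg c j).map ψ
  | _, _, .id a => c.pt.id (ColimitOb.desc c a)
  | _, _, .comp (p := p) (q := q) t t' =>
    c.pt.comp (p := p.map (ColimitOb.desc c)) (q := fun i => (q i).map (ColimitOb.desc c))
      (t.eval c α) (fun i => (t' i).eval c α)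
  | _, _, .act h (p := p) σ t => α h (p := p.map (ColimitOb.desc c)) σ (t.eval c α)

/-- A family of cocones whose vertices carry rearrangements if `s` holds. Both the cocones of
non-symmetric operads and the underlying cocones of cocones of symmetric operads form such
a family. -/
structure CoconeFamily (F : J ⥤ Ope.{u}) (s : Prop) where
  Index : Type (u + 1)
  cocone : Index → Cocone F
  act : ∀ k, s → Rearrangement (cocone k).pt

variable {F : J ⥤ Ope.{u}} {s : Prop} (K : CoconeFamily F s)

/-- Two expressions are identified if they have the same value in all cocones of the family. -/
def ColimitTerm.setoid (p : Tuple (ColimitOb F)) (a : ColimitOb F) :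
    Setoid (ColimitTerm F s p a) where
  r t t' := ∀ k, t.eval (K.cocone k) (K.act k) = t'.eval (K.cocone k) (K.act k)
  iseqv := ⟨fun _ _ => rfl, fun h k => (h k).symm, fun h h' k => (h k).trans (h' k)⟩

/-- The morphisms of the colimit: expressions up to equality of their values in all cocones. -/
def ColimitHom (p : Tuple (ColimitOb F)) (a : ColimitOb F) : Type u :=
  Quotient (ColimitTerm.setoid K p a)

namespace ColimitHom

variable {K}

/-- The class of an expression. -/
def mk {p : Tuple (ColimitOb F)} {a : ColimitOb F} (t : ColimitTerm F s p a) : ColimitHom K p a :=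
  Quotient.mk _ t

/-- The value of a morphism of the colimit in a cocone. -/
def eval (k : K.Index) {p : Tuple (ColimitOb F)} {a : ColimitOb F} (x : ColimitHom K p a) :
    (K.cocone k).pt.Hom (p.map (ColimitOb.desc (K.cocone k))) (ColimitOb.desc (K.cocone k) a) :=
  Quotient.lift (fun t => t.eval (K.cocone k) (K.act k)) (fun _ _ h => by exact h k) x

/-- An expression representing a morphism. -/
noncomputable def out {p : Tuple (ColimitOb F)} {a : ColimitOb F} (x : ColimitHom K p a) :
    ColimitTerm F s p a := Quotient.out x

theorem mk_out {p : Tuple (ColimitOb F)} {a : ColimitOb F} (x : ColimitHom K p a) :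
    mk x.out = x := Quotient.out_eq x

theorem eval_out (k : K.Index) {p : Tuple (ColimitOb F)} {a : ColimitOb F} (x : ColimitHom K p a) :
    x.out.eval (K.cocone k) (K.act k) = x.eval k :=
  congrArg (eval k) (mk_out x)

/-- Morphisms of the colimit are determined by their values in the cocones. Since the vertices of
the cocones are operads, this is what makes the laws of an operad hold in the colimit. -/
theorem ext {p : Tuple (ColimitOb F)} {a : ColimitOb F} {x y : ColimitHom K p a}
    (h : ∀ k, x.eval k = y.eval k) : x = y := by
  rw [← mk_out x, ← mk_out y]
  exact Quotient.sound (s := ColimitTerm.setoid K p a) fun k =>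
    (eval_out k x).trans ((h k).trans (eval_out k y).symm)

theorem hext {p q : Tuple (ColimitOb F)} {a b : ColimitOb F} {x : ColimitHom K p a}
    {y : ColimitHom K q b} (hp : p = q) (ha : a = b) (h : ∀ k, HEq (x.eval k) (y.eval k)) :
    HEq x y := by
  subst hp ha
  exact heq_of_eq (ext fun k => eq_of_heq (h k))

theorem eval_castDom (k : K.Index) {p q : Tuple (ColimitOb F)} {a : ColimitOb F} (h : p = q)
    (x : ColimitHom K p a) :
    (castDom (H := ColimitHom K) h x).eval k =
      castDom (H := (K.cocone k).pt.Hom)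
        (congrArg (Tuple.map (ColimitOb.desc (K.cocone k))) h) (x.eval k) :=
  castDom_natural (H := ColimitHom K) _ (eval k) h x

/-- Composition in the colimit. The choice of representatives is harmless, since the value of
a composite expression only depends on the values of its parts. -/
noncomputable def comp {p : Tuple (ColimitOb F)} {a : ColimitOb F}
    {q : Fin p.len → Tuple (ColimitOb F)} (x : ColimitHom K p a)
    (y : ∀ i, ColimitHom K (q i) (p.get i)) : ColimitHom K (Tuple.concat q) a :=
  mk (.comp x.out (fun i => (y i).out))

theorem eval_comp (k : K.Index) {p : Tuple (ColimitOb F)} {a : ColimitOb F}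
    {q : Fin p.len → Tuple (ColimitOb F)} (x : ColimitHom K p a)
    (y : ∀ i, ColimitHom K (q i) (p.get i)) :
    (comp x y).eval k = (K.cocone k).pt.comp (p := p.map (ColimitOb.desc (K.cocone k)))
      (q := fun i => (q i).map (ColimitOb.desc (K.cocone k))) (x.eval k) (fun i => (y i).eval k) :=
  congrArg₂ ((K.cocone k).pt.comp (p := p.map (ColimitOb.desc (K.cocone k)))
      (q := fun i => (q i).map (ColimitOb.desc (K.cocone k))))
    (eval_out k x) (funext fun i => eval_out k (y i))

/-- Rearrangement of inputs in the colimit. -/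
noncomputable def act (h : s) {p : Tuple (ColimitOb F)} {a : ColimitOb F}
    (σ : Equiv.Perm (Fin p.len)) (x : ColimitHom K p a) : ColimitHom K (p.permute σ) a :=
  mk (.act h σ x.out)

theorem eval_act (k : K.Index) (h : s) {p : Tuple (ColimitOb F)} {a : ColimitOb F}
    (σ : Equiv.Perm (Fin p.len)) (x : ColimitHom K p a) :
    (act h σ x).eval k = K.act k h (p := p.map (ColimitOb.desc (K.cocone k))) σ (x.eval k) :=
  congrArg (K.act k h (p := p.map (ColimitOb.desc (K.cocone k))) σ) (eval_out k x)

end ColimitHom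

/-- The operad generated by a diagram, subject to the equations which hold in a family of
cocones. -/
noncomputable def colimitOpe : Ope.{u} where
  Ob := ColimitOb F
  Hom := ColimitHom K
  id a := .mk (.id a)
  comp := .comp
  id_comp {p a} x := ColimitHom.ext fun k => by
    refine (ColimitHom.eval_castDom k _ _).trans ?_
    refine (congrArg _ (ColimitHom.eval_comp k _ _)).trans ?_
    exact (K.cocone k).pt.id_comp (p := p.map (ColimitOb.desc (K.cocone k))) (x.eval k)
  comp_id {p a} x := ColimitHom.ext fun k => by
    refine (ColimitHom.eval_castDom k _ _).trans ?_
    refine (congrArg _ (ColimitHom.eval_comp k _ _)).trans ?_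
    exact (K.cocone k).pt.comp_id (p := p.map (ColimitOb.desc (K.cocone k))) (x.eval k)
  assoc {p a q r} x y z := ColimitHom.ext fun k => by
    refine (ColimitHom.eval_castDom k _ _).trans (Eq.trans (congrArg _ ?_)
      (((K.cocone k).pt.assoc (p := p.map (ColimitOb.desc (K.cocone k)))
        (q := fun i => (q i).map (ColimitOb.desc (K.cocone k)))
        (s := fun i j => (r i j).map (ColimitOb.desc (K.cocone k))) (x.eval k)
        (fun i => (y i).eval k) (fun i j => (z i j).eval k)).trans ?_))
    · refine (ColimitHom.eval_comp k _ _).trans ?_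
      exact congrArg (fun ψ => (K.cocone k).pt.comp
        (p := (Tuple.concat q).map (ColimitOb.desc (K.cocone k)))
        (q := fun x => (r (Tuple.pos q x).1 (Tuple.pos q x).2).map (ColimitOb.desc (K.cocone k)))
        ψ (fun x => (z (Tuple.pos q x).1 (Tuple.pos q x).2).eval k)) (ColimitHom.eval_comp k x y)
    · refine Eq.trans ?_ (ColimitHom.eval_comp k x (fun i => .comp (y i) (z i))).symm
      exact congrArg ((K.cocone k).pt.comp (p := p.map (ColimitOb.desc (K.cocone k)))
        (q := fun i => (Tuple.concat (r i)).map (ColimitOb.desc (K.cocone k))) (x.eval k))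
        (funext fun i => (ColimitHom.eval_comp k (y i) (z i)).symm)

/-- The functors from the diagram to the colimit. -/
noncomputable def colimitι (j : J) : F.obj j ⟶ colimitOpe K where
  obj a := ColimitOb.mk F j a
  map ψ := ColimitHom.mk (.of j ψ)
  map_id a := ColimitHom.ext fun k => (leg (K.cocone k) j).map_id a
  map_comp {p _ q} ψ φ := ColimitHom.ext fun k =>
    ((leg (K.cocone k) j).map_comp ψ φ).trans (ColimitHom.eval_comp k
      (p := p.map (ColimitOb.mk F j)) (q := fun i => (q i).map (ColimitOb.mk F j))
      (.mk (.of j ψ)) (fun i => .mk (.of j (φ i)))).symm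

/-- The cocone with vertex `colimitOpe K`. -/
noncomputable def colimitCocone : Cocone F where
  pt := colimitOpe K
  ι :=
    { app := colimitι K
      naturality := fun j j' f => by
        have ho : ∀ a, ColimitOb.mk F j' ((F.map f).obj a) = ColimitOb.mk F j a :=
          fun a => (Quot.sound ⟨f, rfl⟩).symm
        exact hom_ext ho fun ψ => ColimitHom.hext (Tuple.ext_get rfl fun _ => ho _) (ho _)
          fun k => congr_map ((K.cocone k).w f) ψ }

/-- The functor from the colimit to the vertex of a cocone of the family. -/
noncomputable def colimitDesc (k : K.Index) : colimitOpe K ⟶ (K.cocone k).pt where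
  obj := ColimitOb.desc (K.cocone k)
  map x := ColimitHom.eval k x
  map_id _ := rfl
  map_comp x y := ColimitHom.eval_comp k x y

/-- A functor out of the colimit which preserves the rearrangements is determined by its restriction
to the diagram, by induction on expressions. -/
theorem colimitDesc_uniq (k : K.Index) (m : colimitOpe K ⟶ (K.cocone k).pt)
    (hm : ∀ j, colimitι K j ≫ m = leg (K.cocone k) j)
    (hact : ∀ (h : s) {p : Tuple (ColimitOb F)} {a : ColimitOb F} (σ : Equiv.Perm (Fin p.len))
      (x : ColimitHom K p a),
      m.map (ColimitHom.act h σ x) = K.act k h (p := p.map m.obj) σ (m.map x)) :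
    m = colimitDesc K k := by
  obtain ⟨o, m, m_id, m_comp⟩ := m
  obtain rfl : o = ColimitOb.desc (K.cocone k) := by
    funext a
    obtain ⟨⟨j, a⟩⟩ := a
    exact congr_obj (hm j) a
  refine hom_ext (fun _ => rfl) fun {p a} x => heq_of_eq ?_
  induction x using Quotient.ind with | _ t
  change m (ColimitHom.mk t) = t.eval (K.cocone k) (K.act k)
  induction t with
  | of j ψ => exact eq_of_heq (congr_map (hm j) ψ)
  | id a => exact m_id a
  | @comp p a q t t' iht iht' =>
    have e : ColimitHom.mk (K := K) (.comp t t') =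
        ColimitHom.comp (.mk t) (fun i => .mk (t' i)) :=
      ColimitHom.ext fun k => (ColimitHom.eval_comp k (.mk t) (fun i => .mk (t' i))).symm
    refine (congrArg m e).trans ((m_comp _ _).trans ?_)
    exact congrArg₂ ((K.cocone k).pt.comp (p := p.map (ColimitOb.desc (K.cocone k)))
      (q := fun i => (q i).map (ColimitOb.desc (K.cocone k)))) iht (funext fun i => iht' i)
  | @act h p a σ t iht =>
    have e : ColimitHom.mk (K := K) (.act h σ t) = ColimitHom.act h σ (.mk t) :=
      ColimitHom.ext fun k => (ColimitHom.eval_act k h σ (.mk t)).symm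
    refine (congrArg m e).trans ((hact h σ _).trans ?_)
    exact congrArg (K.act k h (p := p.map (ColimitOb.desc (K.cocone k))) σ) iht

end Colimits

theorem hasColimits : HasColimits Ope.{u} where
  has_colimits_of_shape J _ := ⟨fun F => by
    let K : CoconeFamily F False :=
      { Index := Cocone F
        cocone := fun c => c
        act := fun _ h => h.elim }
    exact ⟨⟨⟨colimitCocone K,
      { desc := fun c => colimitDesc K c
        fac := fun _ _ => rfl
        uniq := fun c m hm => colimitDesc_uniq K c m hm fun h => h.elim }⟩⟩⟩⟩

end Ope

namespace SymOpe

section Colimits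

variable {J : Type u} [SmallCategory J] (F : J ⥤ SymOpe.{u})

/-- The family of the underlying cocones of all cocones of symmetric operads. -/
def coconeFamily : Ope.CoconeFamily (F ⋙ forget) True where
  Index := Cocone F
  cocone c := forget.mapCocone c
  act c _ := c.pt.act

/-- The map which a cocone of symmetric operads induces on the objects of the colimit. -/
abbrev colimitObDesc {F : J ⥤ SymOpe.{u}} (c : Cocone F) :
    Ope.ColimitOb (F ⋙ forget) → c.pt.Ob :=
  Ope.ColimitOb.desc (forget.mapCocone c)

/-- The colimit of a diagram of symmetric operads. -/
noncomputable def colimitSymOpe : SymOpe.{u} where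
  toOpe := Ope.colimitOpe (coconeFamily F)
  act := Ope.ColimitHom.act trivial
  act_one {p a} x := Ope.ColimitHom.ext fun k =>
    (Ope.ColimitHom.eval_act k trivial _ _).trans
      (k.pt.act_one (p := p.map (colimitObDesc k)) (a := colimitObDesc k a) (x.eval k))
  act_mul {p a} σ τ x := Ope.ColimitHom.ext fun k => by
    refine (Ope.ColimitHom.eval_act k trivial _ _).trans ?_
    refine (k.pt.act_mul (p := p.map (colimitObDesc k)) (a := colimitObDesc k a) σ τ
      (x.eval k)).trans ?_
    refine Eq.trans ?_ (Ope.ColimitHom.eval_act k trivial (p := p.permute σ) τ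
      (.act trivial σ x)).symm
    exact congrArg (k.pt.act (p := (p.permute σ).map (colimitObDesc k)) (a := colimitObDesc k a) τ)
      (Ope.ColimitHom.eval_act k trivial σ x).symm
  act_comp {p a q} σ x y := Ope.ColimitHom.ext fun k => by
    refine (Ope.ColimitHom.eval_comp k _ _).trans ?_
    refine Eq.trans ?_ (Ope.ColimitHom.eval_castDom k (Tuple.concat_perm q σ) _).symm
    refine Eq.trans ?_ ((k.pt.act_comp (p := p.map (colimitObDesc k)) (a := colimitObDesc k a)
      (q := fun i => (q i).map (colimitObDesc k)) σ (x.eval k) (fun i => (y i).eval k)).trans ?_)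
    · exact congrArg (fun ψ => k.pt.comp (p := (p.permute σ).map (colimitObDesc k))
        (a := colimitObDesc k a) (q := fun i => (q (σ i)).map (colimitObDesc k)) ψ
        (fun i => (y (σ i)).eval k)) (Ope.ColimitHom.eval_act k trivial σ x)
    · refine congrArg _ (Eq.trans ?_ (Ope.ColimitHom.eval_act k trivial _ (.comp x y)).symm)
      exact congrArg (k.pt.act (p := (Tuple.concat q).map (colimitObDesc k))
        (a := colimitObDesc k a) _) (Ope.ColimitHom.eval_comp k x y).symm
  comp_act {p a q} τ x y := Ope.ColimitHom.ext fun k => by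
    refine (Ope.ColimitHom.eval_comp k _ _).trans ?_
    refine Eq.trans ?_ (Ope.ColimitHom.eval_castDom k (Tuple.concat_permute q τ) _).symm
    refine Eq.trans ?_ ((k.pt.comp_act (p := p.map (colimitObDesc k)) (a := colimitObDesc k a)
      (q := fun i => (q i).map (colimitObDesc k)) τ (x.eval k) (fun i => (y i).eval k)).trans ?_)
    · exact congrArg (k.pt.comp (p := p.map (colimitObDesc k)) (a := colimitObDesc k a)
        (q := fun i => ((q i).permute (τ i)).map (colimitObDesc k)) (x.eval k))
        (funext fun i => Ope.ColimitHom.eval_act k trivial (τ i) (y i))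
    · refine congrArg _ (Eq.trans ?_ (Ope.ColimitHom.eval_act k trivial _ (.comp x y)).symm)
      exact congrArg (k.pt.act (p := (Tuple.concat q).map (colimitObDesc k))
        (a := colimitObDesc k a) _) (Ope.ColimitHom.eval_comp k x y).symm

/-- The cocone exhibiting `colimitSymOpe F` as a colimit. -/
noncomputable def colimitCocone : Cocone F where
  pt := colimitSymOpe F
  ι :=
    { app := fun j =>
        { toFunctor := Ope.colimitι (coconeFamily F) j
          map_act := fun {p _} σ ψ => Ope.ColimitHom.ext fun k =>
            ((k.ι.app j).map_act σ ψ).trans (Ope.ColimitHom.eval_act k trivial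
              (p := p.map (Ope.ColimitOb.mk (F ⋙ forget) j)) σ (.mk (.of j ψ))).symm }
      naturality := fun _ _ f =>
        hom_ext ((Ope.colimitCocone (coconeFamily F)).ι.naturality f) }

/-- `colimitCocone F` is a colimit cocone. -/
noncomputable def isColimitColimitCocone : IsColimit (colimitCocone F) where
  desc c :=
    { toFunctor := Ope.colimitDesc (coconeFamily F) c
      map_act := fun σ ψ => Ope.ColimitHom.eval_act (K := coconeFamily F) c trivial σ ψ }
  fac _ _ := rfl
  uniq c m hm := hom_ext (Ope.colimitDesc_uniq (coconeFamily F) c (forget.map m)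
    (fun j => congrArg forget.map (hm j)) fun _ => m.map_act)

end Colimits

theorem hasColimits : HasColimits SymOpe.{u} where
  has_colimits_of_shape _ _ := ⟨fun F => ⟨⟨⟨colimitCocone F, isColimitColimitCocone F⟩⟩⟩⟩

end SymOpe

namespace Ope

variable {P Q R : Ope.{u}}

/-! ### Isomorphisms and fully faithful functors -/

/-- The isomorphisms of an operad. -/
abbrev IsoIn (P : Ope.{u}) (a b : P.Ob) : Type u := @CategoryTheory.Iso P.Underlying _ a b

/-- The image of an isomorphism under a functor. -/
abbrev mapIso (F : P ⟶ Q) {a b : P.Ob} (e : IsoIn P a b) : IsoIn Q (F.obj a) (F.obj b) :=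
  (underlyingFunctor F).mapIso e

/-- The identity isomorphism. -/
abbrev reflIso (P : Ope.{u}) (a : P.Ob) : IsoIn P a a := @CategoryTheory.Iso.refl P.Underlying _ a

/-- The isomorphism given by an equality of objects. -/
abbrev isoOfEq {a b : P.Ob} (h : a = b) : IsoIn P a b := @eqToIso P.Underlying _ a b h

theorem exists_isoIn_heq {a a' b : P.Ob} (h : a = a') (e : IsoIn P a' b) :
    ∃ e' : IsoIn P a b, HEq e'.hom e.hom := by
  subst h
  exact ⟨e, HEq.rfl⟩

/-- A functor is fully faithful if all its components are bijections. -/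
def FullyFaithful (F : P ⟶ Q) : Prop :=
  ∀ (p : Tuple P.Ob) (a : P.Ob), Function.Bijective (F.map : P.Hom p a → _)

theorem FullyFaithful.comp {F : P ⟶ Q} {G : Q ⟶ R} (hF : FullyFaithful F) (hG : FullyFaithful G) :
    FullyFaithful (F ≫ G) :=
  fun p a => (hG (p.map F.obj) (F.obj a)).comp (hF p a)

theorem FullyFaithful.of_comp {F : P ⟶ Q} {G : Q ⟶ R} (hG : FullyFaithful G)
    (hFG : FullyFaithful (F ≫ G)) : FullyFaithful F :=
  fun p a => ((hG (p.map F.obj) (F.obj a)).of_comp_iff' (F.map : P.Hom p a → _)).1 (hFG p a)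

theorem fullyFaithful_id (P : Ope.{u}) : FullyFaithful (𝟙 P) :=
  fun _ _ => Function.bijective_id

/-- A fully faithful functor reflects isomorphisms. -/
theorem FullyFaithful.exists_mapIso_eq {F : P ⟶ Q} (hF : FullyFaithful F) {a b : P.Ob}
    (e : IsoIn Q (F.obj a) (F.obj b)) : ∃ e' : IsoIn P a b, mapIso F e' = e := by
  have : (underlyingFunctor F).Full := ⟨fun {a b} f => (hF (Tuple.single a) b).2 f⟩
  have : (underlyingFunctor F).Faithful := ⟨fun {a b} _ _ h => (hF (Tuple.single a) b).1 h⟩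
  exact ⟨(underlyingFunctor F).preimageIso e, Iso.ext ((underlyingFunctor F).map_preimage e.hom)⟩

/-- A functor lifts through a fully faithful functor as soon as it does so on objects. -/
theorem FullyFaithful.exists_lift {F : P ⟶ Q} (hF : FullyFaithful F) (G : R ⟶ Q) (o : R.Ob → P.Ob)
    (ho : ∀ b, F.obj (o b) = G.obj b) : ∃ L : R ⟶ P, o = L.obj ∧ L ≫ F = G := by
  obtain ⟨g, m, m_id, m_comp⟩ := G
  obtain rfl : (fun b => F.obj (o b)) = g := funext ho
  let inv {p : Tuple R.Ob} {a : R.Ob} (ψ : R.Hom p a) : P.Hom (p.map o) (o a) :=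
    (Equiv.ofBijective _ (hF (p.map o) (o a))).symm (m ψ)
  have h_inv {p : Tuple R.Ob} {a : R.Ob} (ψ : R.Hom p a) : F.map (inv ψ) = m ψ :=
    (Equiv.ofBijective _ (hF (p.map o) (o a))).apply_symm_apply (m ψ)
  refine ⟨⟨o, inv, fun a => ?_, fun {p a q} ψ φ => ?_⟩, rfl, ?_⟩
  · exact (hF _ _).1 ((h_inv _).trans ((m_id a).trans (F.map_id (o a)).symm))
  · refine (hF ((Tuple.concat q).map o) (o a)).1 ((h_inv _).trans ((m_comp ψ φ).trans ?_))
    refine Eq.trans ?_ (F.map_comp (p := p.map o) (q := fun i => (q i).map o) (inv ψ)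
      (fun i => inv (φ i))).symm
    exact (congrArg₂ (Q.comp (p := p.map fun b => F.obj (o b))
      (q := fun i => (q i).map fun b => F.obj (o b))) (h_inv ψ) (funext fun i => h_inv (φ i))).symm
  · exact hom_ext (fun _ => rfl) fun ψ => heq_of_eq (h_inv ψ)

theorem FullyFaithful.cancel {F : P ⟶ Q} (hF : FullyFaithful F) {U V : R ⟶ P}
    (ho : U.obj = V.obj) (h : U ≫ F = V ≫ F) : U = V := by
  obtain ⟨o, m, _, _⟩ := U
  obtain ⟨o', m', _, _⟩ := V
  obtain rfl : o = o' := ho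
  refine hom_ext (fun _ => rfl) fun {p a} ψ => heq_of_eq ?_
  exact (hF (p.map o) (o a)).1 (eq_of_heq (congr_map h ψ))

/-! ### Conjugation by isomorphisms -/

/-- Conjugation by isomorphisms is a bijection between sets of morphisms. -/
def conjEquiv {p : Tuple P.Ob} {a b : P.Ob} {r : Fin p.len → P.Ob} (e : IsoIn P a b)
    (f : ∀ i, IsoIn P (p.get i) (r i)) : P.Hom p a ≃ P.Hom ⟨p.len, r⟩ b where
  toFun ψ := P.post e.hom (P.pre ψ fun i => (f i).inv)
  invFun ψ := P.post e.inv (P.pre (p := ⟨p.len, r⟩) (r := p.get) ψ fun i => (f i).hom)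
  left_inv ψ := by
    refine (congrArg (P.post e.inv) (post_pre (p := ⟨p.len, r⟩) (r := p.get) e.hom _ _).symm).trans
      ?_
    refine (post_post e.inv e.hom _).trans ?_
    refine (congrArg₂ P.post (post_inv_hom e) ((pre_pre ψ (fun i => (f i).inv)
      (fun i => (f i).hom)).trans ?_)).trans (post_id ψ)
    exact (congrArg (P.pre (r := p.get) ψ) (funext fun i => post_inv_hom (f i))).trans (pre_id ψ)
  right_inv ψ := by
    refine (congrArg (P.post e.hom) (post_pre e.inv _ _).symm).trans ?_
    refine (post_post e.hom e.inv _).trans ?_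
    refine (congrArg₂ P.post (post_hom_inv e)
      ((pre_pre (p := ⟨p.len, r⟩) (r := p.get) ψ _ _).trans ?_)).trans (post_id _)
    exact (congrArg (P.pre (p := ⟨p.len, r⟩) (r := r) ψ)
      (funext fun i => post_hom_inv (f i))).trans (pre_id ψ)

theorem comp_conjEquiv {p : Tuple P.Ob} {a b : P.Ob} {q : Fin p.len → Tuple P.Ob}
    {r : Fin p.len → P.Ob} {s : ∀ i, Fin (q i).len → P.Ob} (e : IsoIn P a b)
    (f : ∀ i, IsoIn P (p.get i) (r i)) (g : ∀ i j, IsoIn P ((q i).get j) (s i j))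
    (ψ : P.Hom p a) (φ : ∀ i, P.Hom (q i) (p.get i)) :
    P.comp (p := ⟨p.len, r⟩) (q := fun i => ⟨(q i).len, s i⟩) (conjEquiv e f ψ)
        (fun i => conjEquiv (f i) (g i) (φ i)) =
      conjEquiv (p := Tuple.concat q) (r := fun x => s (Tuple.pos q x).1 (Tuple.pos q x).2) e
        (fun x => g (Tuple.pos q x).1 (Tuple.pos q x).2) (P.comp ψ φ) := by
  refine (comp_post (p := ⟨p.len, r⟩) (q := fun i => ⟨(q i).len, s i⟩) e.hom _ _).trans
    (congrArg (P.post e.hom) ?_)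
  refine (comp_pre (q := fun i => ⟨(q i).len, s i⟩) ψ (fun i => (f i).inv) _).trans ?_
  refine Eq.trans (congrArg (P.comp (q := fun i => ⟨(q i).len, s i⟩) ψ) (funext fun i => ?_))
    (comp_pre_right ψ φ fun i j => (g i j).inv)
  exact (post_post (f i).inv (f i).hom _).trans
    ((congrArg (fun x => P.post x _) (post_inv_hom (f i))).trans (post_id _))

/-- The functor obtained from a functor `G` by replacing its values on objects
by isomorphic objects. -/
def conj (G : P ⟶ Q) (y : P.Ob → Q.Ob) (θ : ∀ b, IsoIn Q (G.obj b) (y b)) : P ⟶ Q where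
  obj := y
  map {p a} ψ := conjEquiv (p := p.map G.obj) (r := fun i => y (p.get i)) (θ a)
    (fun i => θ (p.get i)) (G.map ψ)
  map_id a := by
    refine (congrArg (conjEquiv (p := Tuple.single (G.obj a)) (θ a) (fun _ => θ a))
      (G.map_id a)).trans ?_
    refine (congrArg (Q.post (θ a).hom) (post_id (P := Q) (p := Tuple.single (y a))
      (θ a).inv)).trans (post_hom_inv (θ a))
  map_comp {p a q} ψ φ := by
    refine (congrArg (conjEquiv (p := (Tuple.concat q).map G.obj)
      (r := fun i => y ((Tuple.concat q).get i)) (θ a) (fun i => θ ((Tuple.concat q).get i)))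
      (G.map_comp ψ φ)).trans ?_
    exact (comp_conjEquiv (p := p.map G.obj) (q := fun i => (q i).map G.obj)
      (r := fun i => y (p.get i)) (s := fun i j => y ((q i).get j)) (θ a)
      (fun i => θ (p.get i)) (fun i j => θ ((q i).get j)) (G.map ψ) (fun i => G.map (φ i))).symm

theorem mapIso_conj (G : P ⟶ Q) (y : P.Ob → Q.Ob) (θ : ∀ b, IsoIn Q (G.obj b) (y b))
    {a b : P.Ob} (e : IsoIn P a b) :
    mapIso (conj G y θ) e = (θ a).symm ≪≫ mapIso G e ≪≫ θ b := by
  refine Iso.ext ?_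
  exact @Category.assoc Q.Underlying _ _ _ _ _ (θ a).inv (mapIso G e).hom (θ b).hom

theorem conj_congr {G G' : P ⟶ Q} {y y' : P.Ob → Q.Ob} {θ : ∀ b, IsoIn Q (G.obj b) (y b)}
    {θ' : ∀ b, IsoIn Q (G'.obj b) (y' b)} (hG : G = G') (hy : ∀ b, y b = y' b)
    (hθ : ∀ b, HEq (θ b).hom (θ' b).hom) : conj G y θ = conj G' y' θ' := by
  subst hG
  obtain rfl : y = y' := funext hy
  obtain rfl : θ = θ' := funext fun b => Iso.ext (eq_of_heq (hθ b))
  rfl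

/-- Conjugation by identities does not change a functor. -/
theorem conj_refl (G : P ⟶ Q) : conj G G.obj (fun b => reflIso Q (G.obj b)) = G :=
  hom_ext (fun _ => rfl) fun ψ => heq_of_eq ((post_id _).trans (pre_id (G.map ψ)))

/-- Conjugation by isomorphisms and then by their inverses does not change a functor. -/
theorem conj_symm_conj (G : P ⟶ Q) (y : P.Ob → Q.Ob) (θ : ∀ b, IsoIn Q (G.obj b) (y b)) :
    conj (conj G y θ) G.obj (fun b => (θ b).symm) = G :=
  hom_ext (fun _ => rfl) fun {p a} ψ => heq_of_eq
    ((conjEquiv (p := p.map G.obj) (r := fun i => y (p.get i)) (θ a)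
      (fun i => θ (p.get i))).left_inv (G.map ψ))

theorem comp_conj (F : R ⟶ P) (G : P ⟶ Q) (y : P.Ob → Q.Ob) (θ : ∀ b, IsoIn Q (G.obj b) (y b)) :
    F ≫ conj G y θ = conj (F ≫ G) (fun b => y (F.obj b)) (fun b => θ (F.obj b)) :=
  rfl

theorem conj_comp (G : P ⟶ Q) (y : P.Ob → Q.Ob) (θ : ∀ b, IsoIn Q (G.obj b) (y b)) (F : Q ⟶ R) :
    conj G y θ ≫ F = conj (G ≫ F) (fun b => F.obj (y b)) (fun b => mapIso F (θ b)) :=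
  hom_ext (fun _ => rfl) fun {p a} ψ => heq_of_eq <| by
    have e := map_pre F (p := p.map G.obj) (r := fun i => y (p.get i)) (G.map ψ)
      (fun i => (θ (p.get i)).inv)
    exact (map_post F (θ a).hom _).trans (congrArg (R.post (p := p.map fun b => F.obj (y b))
      (a := F.obj (G.obj a)) (F.map (θ a).hom)) e)

theorem fullyFaithful_conj_iff (G : P ⟶ Q) (y : P.Ob → Q.Ob)
    (θ : ∀ b, IsoIn Q (G.obj b) (y b)) : FullyFaithful (conj G y θ) ↔ FullyFaithful G := by
  refine forall_congr' fun p => forall_congr' fun a => ?_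
  exact (conjEquiv (p := p.map G.obj) (r := fun i => y (p.get i)) (θ a)
    (fun i => θ (p.get i))).comp_bijective (G.map : P.Hom p a → _)

end Ope

/-! ### Operadic equivalences -/

namespace Ope

variable {P Q R : Ope.{u}}

theorem operadicEquivalences_iff (F : P ⟶ Q) :
    operadicEquivalences F ↔
      (∀ b : Q.Ob, ∃ a : P.Ob, Nonempty (IsoIn Q (F.obj a) b)) ∧ FullyFaithful F :=
  and_congr ⟨fun h b => h.mem_essImage b, fun h => ⟨h⟩⟩ Iff.rfl

/-- A choice of isomorphisms `β b : F (o b) ≅ b` makes `o` a functor whose composite with the fully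
faithful functor `F` is the conjugate of the identity by the inverses of the `β b`. -/
theorem exists_inverse {F : P ⟶ Q} (hF : FullyFaithful F) (o : Q.Ob → P.Ob)
    (β : ∀ b, IsoIn Q (F.obj (o b)) b) :
    ∃ r : Q ⟶ P, o = r.obj ∧
      r ≫ F = conj (𝟙 Q) (fun b => F.obj (o b)) (fun b => (β b).symm) :=
  hF.exists_lift _ o fun _ => rfl

/-- If `F` is an equivalence with weak inverse `r`, then `r ≫ F ≫ G` is a conjugate of `G`; hence
`G` is fully faithful as soon as `F ≫ G` is. -/
theorem FullyFaithful.of_precomp {F : P ⟶ Q} (hF : operadicEquivalences F) {G : Q ⟶ R}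
    (hFG : FullyFaithful (F ≫ G)) : FullyFaithful G := by
  obtain ⟨hs, hF⟩ := (operadicEquivalences_iff F).1 hF
  choose o β using hs
  obtain ⟨r, -, hr⟩ := exists_inverse hF o fun b => (β b).some
  have hrF : FullyFaithful (r ≫ F) := by
    rw [hr, fullyFaithful_conj_iff]
    exact fullyFaithful_id Q
  have h : FullyFaithful (r ≫ F ≫ G) := (FullyFaithful.of_comp hF hrF).comp hFG
  rw [← Category.assoc, hr, conj_comp, fullyFaithful_conj_iff] at h
  exact h

instance : (operadicEquivalences.{u}).HasTwoOutOfThreeProperty where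
  comp_mem F G hF hG := by
    rw [operadicEquivalences_iff] at *
    refine ⟨fun c => ?_, hF.2.comp hG.2⟩
    obtain ⟨b, ⟨e⟩⟩ := hG.1 c
    obtain ⟨a, ⟨e'⟩⟩ := hF.1 b
    exact ⟨a, ⟨mapIso G e' ≪≫ e⟩⟩
  of_postcomp F G hG hFG := by
    rw [operadicEquivalences_iff] at *
    refine ⟨fun b => ?_, FullyFaithful.of_comp hG.2 hFG.2⟩
    obtain ⟨a, ⟨e⟩⟩ := hFG.1 (G.obj b)
    obtain ⟨e', -⟩ := hG.2.exists_mapIso_eq (a := F.obj a) e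
    exact ⟨a, ⟨e'⟩⟩
  of_precomp F G hF hFG := by
    refine (operadicEquivalences_iff G).2 ⟨fun c => ?_, .of_precomp hF hFG.2⟩
    obtain ⟨a, ⟨e⟩⟩ := ((operadicEquivalences_iff _).1 hFG).1 c
    exact ⟨F.obj a, ⟨e⟩⟩

/-! ### Isofibrations and retracts -/

theorem tuple_map_congr {α β : Type u} {o o' : α → β} (h : ∀ a, o a = o' a) (p : Tuple α) :
    p.map o = p.map o' :=
  Tuple.ext_get rfl fun _ => h _

theorem inv_heq_id {a b : P.Ob} (e : IsoIn P a b) (h : a = b) (he : HEq e.hom (P.id b)) :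
    HEq e.inv (P.id b) := by
  subst h
  obtain rfl : e = reflIso P a := Iso.ext (eq_of_heq he)
  rfl

/-- Isofibrations, with the equalities of objects and of isomorphisms in a flexible form. -/
theorem isofibrations_iff (F : P ⟶ Q) :
    isofibrations F ↔ ∀ (a : P.Ob) (c b : Q.Ob) (_ : F.obj a = c) (ψ : IsoIn Q c b),
      ∃ (a' : P.Ob) (φ : IsoIn P a a'), F.obj a' = b ∧ HEq (F.map φ.hom) ψ.hom := by
  constructor
  · rintro h a _ b rfl ψ
    obtain ⟨a', φ, rfl, e⟩ := h a b ψ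
    exact ⟨a', φ, rfl, heq_of_eq ((Category.comp_id _).symm.trans e)⟩
  · intro h a b ψ
    obtain ⟨a', φ, e, e'⟩ := h a _ b rfl ψ
    obtain rfl : (underlyingFunctor F).obj a' = b := e
    exact ⟨a', φ, rfl, (Category.comp_id _).trans (eq_of_heq e')⟩

instance : (isofibrations.{u}).IsStableUnderRetracts where
  of_retract {X Y Z W f g} h hg := by
    rw [isofibrations_iff] at *
    rintro a _ b rfl ψ
    obtain ⟨z, φ, hz, hφ⟩ := hg (h.i.left.obj a) _ _ (congr_obj h.i_w a) (mapIso h.i.right ψ)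
    obtain ⟨φ', hφ'⟩ := exists_isoIn_heq (congr_obj h.retract_left a).symm (mapIso h.r.left φ)
    have hb : h.r.right.obj (h.i.right.obj b) = b := congr_obj h.retract_right b
    refine ⟨h.r.left.obj z, φ', ?_, ?_⟩
    · exact (congr_obj h.r_w z).trans ((congrArg h.r.right.obj hz).trans hb)
    · have e₁ : HEq (f.map φ'.hom) (f.map (h.r.left.map φ.hom)) :=
        map_heq f (congrArg Tuple.single (congr_obj h.retract_left a).symm) rfl hφ'
      have e₂ : HEq (f.map (h.r.left.map φ.hom)) (h.r.right.map (g.map φ.hom)) :=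
        congr_map h.r_w φ.hom
      have e₃ := map_heq h.r.right (congrArg Tuple.single (congr_obj h.i_w a)) hz hφ
      have e₄ : HEq (h.r.right.map (h.i.right.map ψ.hom)) ψ.hom := congr_map h.retract_right ψ.hom
      exact e₁.trans (e₂.trans (e₃.trans e₄))

instance : (injectiveOnObjects.{u}).IsStableUnderRetracts where
  of_retract {X Y Z W f g} h hg := by
    intro a a' e
    have e₁ : h.i.left.obj a = h.i.left.obj a' :=
      hg ((congr_obj h.i_w a).trans ((congrArg h.i.right.obj e).trans (congr_obj h.i_w a').symm))
    exact (congr_obj h.retract_left a).symm.trans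
      ((congrArg h.r.left.obj e₁).trans (congr_obj h.retract_left a'))

theorem exists_hom_heq {p q : Tuple P.Ob} {a b : P.Ob} (hp : p = q) (ha : a = b) (x : P.Hom p a) :
    ∃ y : P.Hom q b, HEq x y := by
  subst hp ha
  exact ⟨x, HEq.rfl⟩

instance : (operadicEquivalences.{u}).IsStableUnderRetracts where
  of_retract {X Y Z W f g} h hg := by
    rw [operadicEquivalences_iff] at *
    refine ⟨fun b => ?_, fun p a => ⟨fun ψ φ e => ?_, fun ω => ?_⟩⟩
    · obtain ⟨z, ⟨e⟩⟩ := hg.1 (h.i.right.obj b)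
      exact ⟨h.r.left.obj z, ⟨isoOfEq (congr_obj h.r_w z) ≪≫ mapIso h.r.right e ≪≫
        isoOfEq (congr_obj h.retract_right b)⟩⟩
    · have e₁ : g.map (h.i.left.map ψ) = g.map (h.i.left.map φ) :=
        eq_of_heq ((congr_map h.i_w ψ).trans
          ((heq_of_eq (congrArg h.i.right.map e)).trans (congr_map h.i_w φ).symm))
      have e₂ := (hg.2 _ _).1 e₁
      exact eq_of_heq ((congr_map h.retract_left ψ).symm.trans
        ((heq_of_eq (congrArg h.r.left.map e₂)).trans (congr_map h.retract_left φ)))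
    · have hp : ∀ a, h.i.right.obj (f.obj a) = g.obj (h.i.left.obj a) :=
        fun a => (congr_obj h.i_w a).symm
      obtain ⟨ω', hω'⟩ := exists_hom_heq (q := (p.map h.i.left.obj).map g.obj)
        (tuple_map_congr hp p) (hp a) (h.i.right.map ω)
      obtain ⟨τ, rfl⟩ := (hg.2 (p.map h.i.left.obj) (h.i.left.obj a)).2 ω'
      have hp' : ∀ a, h.r.left.obj (h.i.left.obj a) = a := congr_obj h.retract_left
      obtain ⟨ρ, hρ⟩ := exists_hom_heq (q := p) (b := a) (tuple_map_congr hp' p) (hp' a)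
        (h.r.left.map τ)
      refine ⟨ρ, eq_of_heq ?_⟩
      have e₁ := map_heq f (tuple_map_congr hp' p).symm (hp' a).symm hρ.symm
      have e₂ : HEq (f.map (h.r.left.map τ)) (h.r.right.map (g.map τ)) := congr_map h.r_w τ
      have e₃ := map_heq h.r.right (tuple_map_congr hp p).symm (hp a).symm hω'.symm
      have e₄ : HEq (h.r.right.map (h.i.right.map ω)) ω := congr_map h.retract_right ω
      exact e₁.trans (e₂.trans (e₃.trans e₄))

/-! ### Lifting properties -/

theorem surjective_of_isofibration {F : P ⟶ Q} (hF : isofibrations F)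
    (hF' : operadicEquivalences F) : Function.Surjective F.obj := by
  intro b
  obtain ⟨a, ⟨e⟩⟩ := ((operadicEquivalences_iff F).1 hF').1 b
  obtain ⟨a', -, h, -⟩ := (isofibrations_iff F).1 hF a _ b rfl e
  exact ⟨a', h⟩

theorem FullyFaithful.isofibration {F : P ⟶ Q} (hF : FullyFaithful F)
    (hs : Function.Surjective F.obj) : isofibrations F := by
  rw [isofibrations_iff]
  rintro a _ b rfl ψ
  obtain ⟨a', rfl⟩ := hs b
  obtain ⟨φ, rfl⟩ := hF.exists_mapIso_eq ψ
  exact ⟨a', φ, rfl, HEq.rfl⟩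

theorem FullyFaithful.operadicEquivalence {F : P ⟶ Q} (hF : FullyFaithful F)
    (hs : Function.Surjective F.obj) : operadicEquivalences F := by
  refine (operadicEquivalences_iff F).2 ⟨fun b => ?_, hF⟩
  obtain ⟨a, rfl⟩ := hs b
  exact ⟨a, ⟨reflIso Q _⟩⟩

/-- A functor which is injective on objects lifts against a trivial fibration: a lift on objects
extends to morphisms since the trivial fibration is fully faithful. -/
theorem hasLiftingProperty_trivialFibration {A B X Y : Ope.{u}} {i : A ⟶ B} {p : X ⟶ Y}
    (hi : injectiveOnObjects i) (hp : isofibrations p) (hp' : operadicEquivalences p) :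
    HasLiftingProperty i p where
  sq_hasLift {f g} sq := by
    have ho : ∀ b, ∃ x, p.obj x = g.obj b ∧ ∀ a, i.obj a = b → x = f.obj a := by
      intro b
      by_cases h : ∃ a, i.obj a = b
      · obtain ⟨a, rfl⟩ := h
        exact ⟨f.obj a, congr_obj sq.w a, fun a' e => congrArg f.obj (hi e).symm⟩
      · obtain ⟨x, hx⟩ := surjective_of_isofibration hp hp' (g.obj b)
        exact ⟨x, hx, fun a e => (h ⟨a, e⟩).elim⟩
    choose o ho ho' using ho
    obtain ⟨L, rfl, hL⟩ := FullyFaithful.exists_lift hp'.2 g o ho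
    refine ⟨⟨⟨L, FullyFaithful.cancel hp'.2 (funext fun a => ho' _ a rfl) ?_, hL⟩⟩⟩
    rw [Category.assoc, hL, sq.w]

/-- An equivalence which is injective on objects lifts against an isofibration. It has a
retraction `r` with an isomorphism `β` from `r ≫ i` to the identity which is the identity on the
image of `i`; the lift is the conjugate of `r ≫ f` by isomorphisms which lift the image
of `β`. -/
theorem hasLiftingProperty_isofibration {A B X Y : Ope.{u}} {i : A ⟶ B} {p : X ⟶ Y}
    (hi : injectiveOnObjects i) (hi' : operadicEquivalences i) (hp : isofibrations p) :
    HasLiftingProperty i p where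
  sq_hasLift {f g} sq := by
    obtain ⟨hs, hff⟩ := (operadicEquivalences_iff i).1 hi'
    have hβ : ∀ b, ∃ (a : A.Ob) (β : IsoIn B (i.obj a) b),
        ∀ a', i.obj a' = b → a = a' ∧ HEq β.hom (B.id b) := by
      intro b
      by_cases h : ∃ a, i.obj a = b
      · obtain ⟨a, rfl⟩ := h
        exact ⟨a, reflIso B _, fun a' e => ⟨(hi e).symm, HEq.rfl⟩⟩
      · obtain ⟨a, ⟨β⟩⟩ := hs b
        exact ⟨a, β, fun a' e => (h ⟨a', e⟩).elim⟩
    -- The isomorphisms are identities on the image of `i`, so that `r` is a strict retraction.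
    choose o β hβ using hβ
    obtain ⟨r, rfl, hr⟩ := exists_inverse hff o β
    have hir : i ≫ r = 𝟙 A := by
      refine hff.cancel (funext fun a => (hβ _ a rfl).1) ?_
      rw [Category.assoc, hr, comp_conj, Category.id_comp]
      refine (conj_congr (Category.comp_id i) (fun a => ?_) fun a => ?_).trans (conj_refl i)
      · exact congrArg i.obj (hβ _ a rfl).1
      · exact inv_heq_id (β (i.obj a)) (congrArg i.obj (hβ _ a rfl).1) (hβ _ a rfl).2
    -- Lifts of the isomorphisms `g (β b)` through `p`, identities on the image of `i`.
    have hξ : ∀ b, ∃ (x : X.Ob) (ξ : IsoIn X (f.obj (r.obj b)) x), p.obj x = g.obj b ∧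
        HEq (p.map ξ.hom) (g.map (β b).hom) ∧
          ∀ a, i.obj a = b → x = f.obj a ∧ HEq ξ.hom (X.id (f.obj a)) := by
      intro b
      have w := congr_obj sq.w (r.obj b)
      by_cases h : ∃ a, i.obj a = b
      · obtain ⟨a, rfl⟩ := h
        have h₁ := (hβ _ a rfl).1
        have h₂ : p.obj (f.obj (r.obj (i.obj a))) = g.obj (i.obj a) :=
          w.trans (congrArg (fun a => g.obj (i.obj a)) h₁)
        refine ⟨f.obj (r.obj (i.obj a)), reflIso X _, h₂, ?_, fun a' e => ?_⟩
        · refine (heq_of_eq (p.map_id _)).trans ((id_heq Y h₂).trans ?_)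
          refine (heq_of_eq (g.map_id _).symm).trans ?_
          exact map_heq g (congrArg (fun a => Tuple.single (i.obj a)) h₁.symm) rfl
            (hβ _ a rfl).2.symm
        · have h₃ := congrArg f.obj (h₁.trans (hi e).symm)
          exact ⟨h₃, id_heq X h₃⟩
      · obtain ⟨x, ξ, hx, hξ⟩ := (isofibrations_iff p).1 hp _ _ _ w (mapIso g (β b))
        exact ⟨x, ξ, hx, hξ, fun a e => (h ⟨a, e⟩).elim⟩
    choose x ξ hx hξ hξ' using hξ
    refine ⟨⟨⟨conj (r ≫ f) x ξ, ?_, ?_⟩⟩⟩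
    · rw [comp_conj]
      refine (conj_congr ?_ (fun a => (hξ' _ a rfl).1) fun a => (hξ' _ a rfl).2).trans (conj_refl f)
      rw [← Category.assoc, hir, Category.id_comp]
    · have h₁ : conj (r ≫ i) (𝟙 B : B ⟶ B).obj β = 𝟙 B :=
        (conj_congr hr (fun _ => rfl) fun _ => HEq.rfl).trans
          (conj_symm_conj (𝟙 B) _ fun b => (β b).symm)
      have h₂ : conj (r ≫ i) (𝟙 B : B ⟶ B).obj β ≫ g = g := by rw [h₁, Category.id_comp]
      rw [conj_comp] at h₂ ⊢
      refine Eq.trans (conj_congr (G' := (r ≫ i) ≫ g) (y' := g.obj)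
        (θ' := fun b => mapIso g (β b)) ?_ hx hξ) h₂
      rw [Category.assoc, sq.w, Category.assoc]

end Ope

/-! ### Factorizations -/

namespace Ope

variable {P Q R : Ope.{u}}

/-- The operad with the set of objects `S` whose morphisms are those of `P` between the images of
the objects. -/
def pullbackOpe (P : Ope.{u}) {S : Type u} (s : S → P.Ob) : Ope.{u} where
  Ob := S
  Hom p a := P.Hom (p.map s) (s a)
  id a := P.id (s a)
  comp {p _ q} ψ φ := P.comp (p := p.map s) (q := fun i => (q i).map s) ψ φ
  id_comp {p _} ψ := (castDom_natural (H := fun p a => P.Hom (p.map s) (s a)) (K := P.Hom) s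
    (fun ψ => ψ) _ _).trans (P.id_comp (p := p.map s) ψ)
  comp_id {p _} ψ := (castDom_natural (H := fun p a => P.Hom (p.map s) (s a)) (K := P.Hom) s
    (fun ψ => ψ) _ _).trans (P.comp_id (p := p.map s) ψ)
  assoc {p _ q r} ψ φ χ := (castDom_natural (H := fun p a => P.Hom (p.map s) (s a)) (K := P.Hom) s
    (fun ψ => ψ) _ _).trans (P.assoc (p := p.map s) (q := fun i => (q i).map s)
      (s := fun i j => (r i j).map s) ψ φ χ)

/-- The fully faithful functor from `pullbackOpe P s` to `P`. -/
def pullbackπ (P : Ope.{u}) {S : Type u} (s : S → P.Ob) : pullbackOpe P s ⟶ P where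
  obj := s
  map ψ := ψ
  map_id _ := rfl
  map_comp _ _ := rfl

theorem fullyFaithful_pullbackπ (P : Ope.{u}) {S : Type u} (s : S → P.Ob) :
    FullyFaithful (pullbackπ P s) :=
  fun _ _ => Function.bijective_id

/-- Every functor factors as a functor injective on objects followed by a fully faithful functor
surjective on objects: the objects in the middle are those of the source together with
those of the target. -/
theorem exists_factorization_trivialFibration (F : P ⟶ Q) :
    ∃ (S : Type u) (s : S → Q.Ob) (i : P ⟶ pullbackOpe Q s), i ≫ pullbackπ Q s = F ∧
      injectiveOnObjects i ∧ Function.Surjective (pullbackπ Q s).obj := by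
  obtain ⟨i, hi, h⟩ := (fullyFaithful_pullbackπ Q (Sum.elim F.obj fun b => b)).exists_lift F Sum.inl
    fun _ => rfl
  refine ⟨_, _, i, h, ?_, fun b => ⟨Sum.inr b, rfl⟩⟩
  change Function.Injective i.obj
  rw [← hi]
  exact Sum.inl_injective

theorem symm_trans_refl_trans {C : Type*} [Category* C] {a b c : C} (ψ : a ≅ b) (χ : b ≅ c) :
    ψ.symm ≪≫ Iso.refl a ≪≫ ψ ≪≫ χ = χ := by
  simp

/-- Every functor `F` factors as an equivalence injective on objects followed by an isofibration:
the objects in the middle are the isomorphisms `F x ≅ y`, with the morphisms between the objects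
`x`. -/
theorem exists_factorization_isofibration (F : P ⟶ Q) :
    ∃ (S : Type u) (s : S → P.Ob) (i : P ⟶ pullbackOpe P s) (p : pullbackOpe P s ⟶ Q),
      i ≫ pullbackπ P s = 𝟙 P ∧ i ≫ p = F ∧
      injectiveOnObjects i ∧ operadicEquivalences i ∧ isofibrations p := by
  let S : Type u := Σ (x : P.Ob) (y : Q.Ob), IsoIn Q (F.obj x) y
  let s : S → P.Ob := fun z => z.1
  have hs := fullyFaithful_pullbackπ P s
  obtain ⟨i, hio, hi⟩ := hs.exists_lift (𝟙 P) (fun x => ⟨x, F.obj x, reflIso Q _⟩) fun _ => rfl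
  let p : pullbackOpe P s ⟶ Q := conj (pullbackπ P s ≫ F) (fun z : S => z.2.1) (fun z => z.2.2)
  refine ⟨S, s, i, p, hi, ?_, ?_, ?_, ?_⟩
  · refine (comp_conj i _ _ _).trans (Eq.trans (conj_congr ?_ ?_ ?_) (conj_refl F))
    · rw [← Category.assoc, hi, Category.id_comp]
    · rw [← hio]
      exact fun _ => rfl
    · intro x
      have e : i.obj x = (⟨x, F.obj x, reflIso Q _⟩ : S) := (congrFun hio x).symm
      have h : ∀ z : S, z = ⟨x, F.obj x, reflIso Q _⟩ →
          HEq z.2.2.hom (reflIso Q (F.obj x)).hom := by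
        rintro _ rfl
        rfl
      exact h _ e
  · change Function.Injective i.obj
    rw [← hio]
    exact fun x y h => congrArg s h
  · refine (operadicEquivalences_iff i).2 ⟨fun z => ⟨s z, ?_⟩, FullyFaithful.of_comp hs ?_⟩
    · obtain ⟨e, -⟩ := hs.exists_mapIso_eq (a := i.obj (s z)) (b := z)
        (isoOfEq (congr_obj hi (s z)))
      exact ⟨e⟩
    · rw [hi]
      exact fullyFaithful_id P
  · rw [isofibrations_iff]
    rintro ⟨x, y, ψ⟩ _ b rfl χ
    obtain ⟨e, he⟩ := hs.exists_mapIso_eq (a := (⟨x, y, ψ⟩ : S)) (b := (⟨x, b, ψ ≪≫ χ⟩ : S))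
      (reflIso P x)
    refine ⟨(⟨x, b, ψ ≪≫ χ⟩ : S), e, rfl, heq_of_eq ?_⟩
    have h₁ : mapIso p e = ψ.symm ≪≫ mapIso F (reflIso P x) ≪≫ (ψ ≪≫ χ) := by
      rw [← he]
      exact mapIso_conj _ _ _ e
    have h₂ : mapIso F (reflIso P x) = reflIso Q (F.obj x) := (underlyingFunctor F).mapIso_refl x
    rw [h₂] at h₁
    exact congrArg Iso.hom (h₁.trans (symm_trans_refl_trans ψ χ))

/-! ### The terminal and the initial operad -/

/-- The operad with one object and one morphism of each arity. -/
def pointOpe : Ope.{u} where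
  Ob := PUnit
  Hom _ _ := PUnit
  id _ := ⟨⟩
  comp _ _ := ⟨⟩
  id_comp _ := rfl
  comp_id _ := rfl
  assoc _ _ _ := rfl

/-- The functor to `pointOpe`. -/
def toPoint (P : Ope.{u}) : P ⟶ pointOpe where
  obj _ := ⟨⟩
  map _ := ⟨⟩
  map_id _ := rfl
  map_comp _ _ := rfl

/-- The operad without objects. -/
def emptyOpe : Ope.{u} where
  Ob := PEmpty
  Hom _ _ := PEmpty
  id a := a.elim
  comp ψ _ := ψ.elim
  id_comp ψ := ψ.elim
  comp_id ψ := ψ.elim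
  assoc ψ _ _ := ψ.elim

/-- A terminal operad is a retract of `pointOpe`; hence it has at most one object and at most
one morphism of each arity, and isomorphisms lift along any functor to it. -/
theorem isofibration_of_retract_point (F : P ⟶ Q) (r : pointOpe ⟶ Q) (h : toPoint Q ≫ r = 𝟙 Q) :
    isofibrations F := by
  have ho : ∀ b b' : Q.Ob, b = b' := fun b b' => (congr_obj h b).symm.trans (congr_obj h b')
  rw [isofibrations_iff]
  intro a c b _ ψ
  refine ⟨a, reflIso P a, ho _ _, ?_⟩
  exact (congr_map h (F.map (P.id a))).symm.trans (congr_map h ψ.hom)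

theorem injectiveOnObjects_of_empty (F : P ⟶ Q) (r : P ⟶ emptyOpe) : injectiveOnObjects F :=
  fun a _ _ => (r.obj a).elim

end Ope

/-! ### The model structure on non-symmetric operads -/

namespace Ope

/-- The model structure on non-symmetric operads. -/
abbrev modelCategory : ModelCategory Ope.{u} :=
  { categoryWithFibrations := ⟨isofibrations⟩
    categoryWithCofibrations := ⟨injectiveOnObjects⟩
    categoryWithWeakEquivalences := ⟨operadicEquivalences⟩
    cm1a := have := hasLimits.{u}; inferInstance
    cm1b := have := hasColimits.{u}; inferInstance
    cm2 := (inferInstance : (operadicEquivalences.{u}).HasTwoOutOfThreeProperty)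
    cm3a := (inferInstance : (operadicEquivalences.{u}).IsStableUnderRetracts)
    cm3b := (inferInstance : (isofibrations.{u}).IsStableUnderRetracts)
    cm3c := (inferInstance : (injectiveOnObjects.{u}).IsStableUnderRetracts)
    cm4a := fun i p hi hi' hp => hasLiftingProperty_isofibration hi.mem hi'.mem hp.mem
    cm4b := fun i p hi hp hp' => hasLiftingProperty_trivialFibration hi.mem hp.mem hp'.mem
    cm5a := ⟨fun F => by
      obtain ⟨S, s, i, p, -, fac, hi, hi', hp⟩ := exists_factorization_isofibration F
      exact ⟨{ Z := _, i := i, p := p, fac := fac, hi := ⟨hi, hi'⟩, hp := hp }⟩⟩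
    cm5b := ⟨fun F => by
      obtain ⟨S, s, i, fac, hi, hp⟩ := exists_factorization_trivialFibration F
      have h := fullyFaithful_pullbackπ _ s
      exact ⟨{ Z := _, i := i, p := _, fac := fac, hi := hi,
               hp := ⟨h.isofibration hp, h.operadicEquivalence hp⟩ }⟩⟩ }

end Ope

namespace SymOpe

variable {P Q R : SymOpe.{u}}

/-! ### Equivariance -/

/-- A functor between the underlying operads of symmetric operads is equivariant if it respects
the actions of the symmetric groups. -/
def IsEquivariant (P Q : SymOpe.{u}) (F : P.toOpe ⟶ Q.toOpe) : Prop :=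
  ∀ {p : Tuple P.Ob} {a : P.Ob} (σ : Equiv.Perm (Fin p.len)) (ψ : P.Hom p a),
    F.map (P.act σ ψ) = Q.act (p := p.map F.obj) σ (F.map ψ)

/-- The functor of symmetric operads given by an equivariant functor. -/
def homMk (F : P.toOpe ⟶ Q.toOpe) (hF : IsEquivariant P Q F) : P ⟶ Q where
  toFunctor := F
  map_act := hF

theorem isEquivariant_map (F : P ⟶ Q) : IsEquivariant P Q (forget.map F) :=
  F.map_act

/-- A lift through an equivariant fully faithful functor is equivariant. -/
theorem IsEquivariant.of_comp_right {L : P.toOpe ⟶ Q.toOpe} {F : Q.toOpe ⟶ R.toOpe}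
    {M : P.toOpe ⟶ R.toOpe} (hF : IsEquivariant Q R F) (hff : Ope.FullyFaithful F)
    (hM : IsEquivariant P R M) (h : L ≫ F = M) : IsEquivariant P Q L := by
  subst h
  intro p a σ ψ
  exact (hff ((p.permute σ).map L.obj) (L.obj a)).1
    ((hM σ ψ).trans (hF (p := p.map L.obj) σ (L.map ψ)).symm)

/-- An extension along an equivariant equivalence is equivariant: each morphism is conjugate to one
in the image of the equivalence. -/
theorem IsEquivariant.of_comp_left {F : P.toOpe ⟶ Q.toOpe} {L : Q.toOpe ⟶ R.toOpe}
    {M : P.toOpe ⟶ R.toOpe} (hF : IsEquivariant P Q F) (hF' : Ope.operadicEquivalences F)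
    (hM : IsEquivariant P R M) (h : F ≫ L = M) : IsEquivariant Q R L := by
  subst h
  obtain ⟨hs, hff⟩ := (Ope.operadicEquivalences_iff F).1 hF'
  choose o β using hs
  intro q b σ ψ
  -- The morphism `ψ` is the composite of `F φ` with isomorphisms, and the actions of permutations
  -- commute with composition with unary morphisms.
  let p : Tuple P.Ob := q.map o
  obtain ⟨ψ', rfl⟩ := (Ope.conjEquiv (p := p.map F.obj) (r := q.get) (β b).some
    (fun i => (β (q.get i)).some)).surjective ψ
  obtain ⟨φ, rfl⟩ := (hff p (o b)).2 ψ'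
  set g := (β b).some.hom with hg
  let f : ∀ i, Q.Hom (Tuple.single (q.get i)) (F.obj (p.get i)) :=
    fun i => (β (q.get i)).some.inv
  have e₁ : Q.act σ (Q.post g (Q.pre (p := p.map F.obj) (r := q.get) (F.map φ) f)) =
      Q.post g (Q.pre (p := (p.permute σ).map F.obj) (r := fun i => q.get (σ i))
        (F.map (P.act σ φ)) (fun i => f (σ i))) := by
    refine (Q.act_post (p := q) σ g _).trans (congrArg (Q.post g) ?_)
    refine (Q.act_pre (p := p.map F.obj) (r := q.get) σ (F.map φ) f).trans ?_
    exact congrArg (fun x => Q.pre (p := (p.permute σ).map F.obj) (r := fun i => q.get (σ i)) x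
      (fun i => f (σ i))) (hF σ φ).symm
  have e₂ : L.map (Q.post g (Q.pre (p := p.map F.obj) (r := q.get) (F.map φ) f)) =
      R.post (L.map g) (R.pre (p := p.map (F ≫ L).obj) (r := fun i => L.obj (q.get i))
        ((F ≫ L).map φ) (fun i => L.map (f i))) :=
    (Ope.map_post L g _).trans (congrArg (R.post (p := q.map L.obj) (L.map g))
      (Ope.map_pre L (p := p.map F.obj) (r := q.get) (F.map φ) f))
  have e₃ : L.map (Q.post g (Q.pre (p := (p.permute σ).map F.obj) (r := fun i => q.get (σ i))
        (F.map (P.act σ φ)) (fun i => f (σ i)))) =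
      R.post (L.map g) (R.pre (p := (p.permute σ).map (F ≫ L).obj)
        (r := fun i => L.obj (q.get (σ i))) ((F ≫ L).map (P.act σ φ))
          (fun i => L.map (f (σ i)))) :=
    (Ope.map_post L g _).trans (congrArg (R.post (p := (q.permute σ).map L.obj) (L.map g))
      (Ope.map_pre L (p := (p.permute σ).map F.obj) (r := fun i => q.get (σ i))
        (F.map (P.act σ φ)) (fun i => f (σ i))))
  refine (congrArg L.map e₁).trans (e₃.trans ?_)
  refine Eq.trans ?_ (congrArg (R.act (p := q.map L.obj) σ) e₂).symm
  refine Eq.trans ?_ (R.act_post (p := q.map L.obj) σ (L.map g)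
    (R.pre (p := p.map (F ≫ L).obj) (r := fun i => L.obj (q.get i)) ((F ≫ L).map φ)
      (fun i => L.map (f i)))).symm
  refine congrArg (R.post (p := (q.permute σ).map L.obj) (a := L.obj (F.obj (o b))) (L.map g)) ?_
  refine Eq.trans ?_ (R.act_pre (p := p.map (F ≫ L).obj) (r := fun i => L.obj (q.get i)) σ
    ((F ≫ L).map φ) (fun i => L.map (f i))).symm
  exact congrArg (fun x => R.pre (p := (p.permute σ).map (F ≫ L).obj)
    (r := fun i => L.obj (q.get (σ i))) x (fun i => L.map (f (σ i)))) (hM σ φ)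

/-! ### The model structure on symmetric operads -/

/-- The symmetric operad with set of objects `S` whose morphisms are those of `P` between
the images of the objects. -/
def pullbackSymOpe (P : SymOpe.{u}) {S : Type u} (s : S → P.Ob) : SymOpe.{u} where
  toOpe := Ope.pullbackOpe P.toOpe s
  act {p a} σ ψ := P.act (p := p.map s) (a := s a) σ ψ
  act_one {p a} ψ := P.act_one (p := p.map s) (a := s a) ψ
  act_mul {p a} σ τ ψ := P.act_mul (p := p.map s) (a := s a) σ τ ψ
  act_comp {p a q} σ ψ φ := by
    refine Eq.trans ?_ (castDom_natural (H := fun p a => P.Hom (p.map s) (s a)) (K := P.Hom) s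
      (fun ψ => ψ) (Tuple.concat_perm q σ) _).symm
    exact P.act_comp (p := p.map s) (a := s a) (q := fun i => (q i).map s) σ ψ φ
  comp_act {p a q} τ ψ φ := by
    refine Eq.trans ?_ (castDom_natural (H := fun p a => P.Hom (p.map s) (s a)) (K := P.Hom) s
      (fun ψ => ψ) (Tuple.concat_permute q τ) _).symm
    exact P.comp_act (p := p.map s) (a := s a) (q := fun i => (q i).map s) τ ψ φ

theorem isEquivariant_pullbackπ (P : SymOpe.{u}) {S : Type u} (s : S → P.Ob) :
    IsEquivariant (pullbackSymOpe P s) P (Ope.pullbackπ P.toOpe s) :=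
  fun _ _ => rfl

/-- The lift of the underlying non-symmetric operads is equivariant. -/
theorem hasLiftingProperty_of_trivialFibration {A B X Y : SymOpe.{u}} {i : A ⟶ B} {p : X ⟶ Y}
    (hp : Ope.FullyFaithful (forget.map p))
    (h : HasLiftingProperty (forget.map i) (forget.map p)) : HasLiftingProperty i p where
  sq_hasLift {f g} sq := by
    have sq' := sq.map forget
    have hL : IsEquivariant B X sq'.lift :=
      IsEquivariant.of_comp_right (isEquivariant_map p) hp (isEquivariant_map g) sq'.fac_right
    exact ⟨⟨⟨homMk sq'.lift hL, hom_ext sq'.fac_left, hom_ext sq'.fac_right⟩⟩⟩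

/-- The lift of the underlying non-symmetric operads is equivariant. -/
theorem hasLiftingProperty_of_trivialCofibration {A B X Y : SymOpe.{u}} {i : A ⟶ B} {p : X ⟶ Y}
    (hi : Ope.operadicEquivalences (forget.map i))
    (h : HasLiftingProperty (forget.map i) (forget.map p)) : HasLiftingProperty i p where
  sq_hasLift {f g} sq := by
    have sq' := sq.map forget
    have hL : IsEquivariant B X sq'.lift :=
      IsEquivariant.of_comp_left (isEquivariant_map i) hi (isEquivariant_map f) sq'.fac_left
    exact ⟨⟨⟨homMk sq'.lift hL, hom_ext sq'.fac_left, hom_ext sq'.fac_right⟩⟩⟩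

/-- The model structure on symmetric operads. -/
abbrev modelCategory : ModelCategory SymOpe.{u} :=
  { categoryWithFibrations := ⟨isofibrations⟩
    categoryWithCofibrations := ⟨injectiveOnObjects⟩
    categoryWithWeakEquivalences := ⟨operadicEquivalences⟩
    cm1a := have := hasLimits.{u}; inferInstance
    cm1b := have := hasColimits.{u}; inferInstance
    cm2 := (inferInstance :
      ((Ope.operadicEquivalences.{u}).inverseImage forget).HasTwoOutOfThreeProperty)
    cm3a := (inferInstance :
      ((Ope.operadicEquivalences.{u}).inverseImage forget).IsStableUnderRetracts)
    cm3b := (inferInstance : ((Ope.isofibrations.{u}).inverseImage forget).IsStableUnderRetracts)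
    cm3c := (inferInstance :
      ((Ope.injectiveOnObjects.{u}).inverseImage forget).IsStableUnderRetracts)
    cm4a := fun i p hi hi' hp => hasLiftingProperty_of_trivialCofibration hi'.mem
      (Ope.hasLiftingProperty_isofibration hi.mem hi'.mem hp.mem)
    cm4b := fun i p hi hp hp' => hasLiftingProperty_of_trivialFibration hp'.mem.2
      (Ope.hasLiftingProperty_trivialFibration hi.mem hp.mem hp'.mem)
    cm5a := ⟨fun {P Q} F => by
      obtain ⟨S, s, i, p, hs, fac, hi, hi', hp⟩ :=
        Ope.exists_factorization_isofibration (forget.map F)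
      have hie : IsEquivariant P (pullbackSymOpe P s) i :=
        IsEquivariant.of_comp_right (isEquivariant_pullbackπ P s) (Ope.fullyFaithful_pullbackπ _ s)
          (isEquivariant_map (𝟙 P)) hs
      have hpe : IsEquivariant (pullbackSymOpe P s) Q p :=
        IsEquivariant.of_comp_left hie hi' (isEquivariant_map F) fac
      exact ⟨{ Z := pullbackSymOpe P s, i := homMk i hie, p := homMk p hpe, fac := hom_ext fac,
               hi := ⟨hi, hi'⟩, hp := hp }⟩⟩
    cm5b := ⟨fun {P Q} F => by
      obtain ⟨S, s, i, fac, hi, hp⟩ := Ope.exists_factorization_trivialFibration (forget.map F)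
      have h := Ope.fullyFaithful_pullbackπ _ s
      have hie : IsEquivariant P (pullbackSymOpe Q s) i :=
        IsEquivariant.of_comp_right (isEquivariant_pullbackπ Q s) h (isEquivariant_map F) fac
      exact ⟨{ Z := pullbackSymOpe Q s, i := homMk i hie,
               p := homMk _ (isEquivariant_pullbackπ Q s), fac := hom_ext fac, hi := hi,
               hp := ⟨h.isofibration hp, h.operadicEquivalence hp⟩ }⟩⟩ }

/-- The symmetric operad with one object and one morphism of each arity. -/
def pointSymOpe : SymOpe.{u} where
  toOpe := Ope.pointOpe
  act _ _ := ⟨⟩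
  act_one _ := rfl
  act_mul _ _ _ := rfl
  act_comp _ _ _ := rfl
  comp_act _ _ _ := rfl

/-- The symmetric operad without objects. -/
def emptySymOpe : SymOpe.{u} where
  toOpe := Ope.emptyOpe
  act _ ψ := ψ.elim
  act_one ψ := ψ.elim
  act_mul _ _ ψ := ψ.elim
  act_comp _ ψ _ := ψ.elim
  comp_act _ ψ _ := ψ.elim

end SymOpe

theorem mainTheorem1 :
    (HasLimits Ope.{u} ∧ HasColimits Ope.{u} ∧
      ∃ _M : ModelCategory Ope.{u},
        weakEquivalences Ope.{u} = Ope.operadicEquivalences ∧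
        cofibrations Ope.{u} = Ope.injectiveOnObjects ∧
        fibrations Ope.{u} = Ope.isofibrations ∧
        ∀ P : Ope.{u}, IsFibrant P ∧ IsCofibrant P) ∧
    (HasLimits SymOpe.{u} ∧ HasColimits SymOpe.{u} ∧
      ∃ _M : ModelCategory SymOpe.{u},
        weakEquivalences SymOpe.{u} = SymOpe.operadicEquivalences ∧
        cofibrations SymOpe.{u} = SymOpe.injectiveOnObjects ∧
        fibrations SymOpe.{u} = SymOpe.isofibrations ∧
        ∀ P : SymOpe.{u}, IsFibrant P ∧ IsCofibrant P) := by
  let _ := Ope.modelCategory.{u}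
  let _ := SymOpe.modelCategory.{u}
  refine ⟨⟨Ope.hasLimits, Ope.hasColimits, Ope.modelCategory, rfl, rfl, rfl,
      fun P => ⟨⟨?_⟩, ⟨?_⟩⟩⟩,
    ⟨SymOpe.hasLimits, SymOpe.hasColimits, SymOpe.modelCategory, rfl, rfl, rfl,
      fun P => ⟨⟨?_⟩, ⟨?_⟩⟩⟩⟩
  · exact Ope.isofibration_of_retract_point _ (terminal.from Ope.pointOpe) (terminal.hom_ext _ _)
  · exact Ope.injectiveOnObjects_of_empty _ (initial.to Ope.emptyOpe)
  · refine Ope.isofibration_of_retract_point _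
      (SymOpe.forget.map (terminal.from SymOpe.pointSymOpe)) ?_
    exact congrArg SymOpe.forget.map (terminal.hom_ext
      (SymOpe.homMk (Ope.toPoint _) (fun _ _ => rfl) ≫ terminal.from SymOpe.pointSymOpe) (𝟙 _))
  · exact Ope.injectiveOnObjects_of_empty _
      (SymOpe.forget.map (initial.to SymOpe.emptySymOpe))
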